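/- Let $M_j=\begin{pmatrix}A_j&B_j\\C_j&D_j\end{pmatrix}$, $j=1,2$, be real matrices with $A_jD_j-B_jC_j=1$ and $B_j\neq0$. For $f\in L^2(\mathbb R)$ and $m,n\in\mathbb Z$ put $$f_{M_1,M_2,m,n}(t)=2^{m/2}f(2^mt-n)\,e^{-\frac i2\left\{\left(t^2-\left(\frac n{2^m}\right)^2\right)\frac{A_1}{B_1}-(2^mt-n)^2\frac{A_2}{B_2}-\frac{2(2^mt+n)}{B_1}\right\}}.$$ Let $(V_m)_{m\in\mathbb Z}$ be closed subspaces of $L^2(\mathbb R)$ forming an orthogonal multiresolution analysis with scaling function $\phi\in L^2(\mathbb R)$, that is: $V_m\subset V_{m+1}$ for all $m$; for all $m$ and all $f\in L^2(\mathbb R)$, $f\in V_m$ if and only if the function $f(2t)e^{\frac{iA_1}{2B_1}\{(2t)^2-t^2\}}$ belongs to $V_{m+1}$; $\bigcap_mV_m=\{0\}$ and $\overline{\bigcup_mV_m}=L^2(\mathbb R)$; and $\{\phi_{M_1,M_2,0,n}\}_{n\in\mathbb Z}$ is an orthonormal basis of $V_0$. Let $W_0=V_1\ominus V_0$ be the orthogonal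 complement of $V_0$ in $V_1$, and let $c_n=\langle\phi_{M_1,M_2,0,0},\phi_{M_1,M_2,1,n}\rangle$, $n\in\mathbb Z$, be the coefficients of $\phi_{M_1,M_2,0,0}$ with respect to $\{\phi_{M_1,M_2,1,n}\}_{n\in\mathbb Z}$. (1) Let $\psi\in L^2(\mathbb R)$ and let $(d_n)_{n\in\mathbb Z}$ be complex numbers such that $$\psi(t)=\sum_{n\in\mathbb Z}d_n\sqrt2\,\phi(2t-n)\,e^{\frac i2\left\{\frac{n^2A_1}{4B_1}+(3t^2-4tn+n^2)\frac{A_2}{B_2}+\frac{2(t+n)}{B_1}\right\}}$$ with (unconditional) convergence in $L^2(\mathbb R)$. Put $$\Lambda(u)=\frac{\sqrt2}2\sum_{n\in\mathbb Z}c_ne^{\frac i2\left(\frac{n^2A_1}{4B_1}+\frac{4n}{B_1}-\frac{2nu}{B_2}\right)},\qquad \Gamma(u)=\frac{\sqrt2}2\sum_{n\in\mathbb Z}d_ne^{\frac i2\left(\frac{n^2A_1}{4B_1}+\frac{4n}{B_1}-\frac{2nu}{B_2}\right)},$$ the series converging in $L^2$ over a period $2\pi|B_2|$, and $$U\Big(\frac{B_2u}{B_1}\Big)=\begin{pmatrix}\Lambda\left(\frac{B_2u}{B_1}\right)&\Lambda\left(\frac{B_2}{B_1}(u+\pi|B_1|)\right)\\[2pt]\Gamma\left(\frac{B_2u}{B_1}\right)&\Gamma\left(\frac{B_2}{B_1}(u+\pi|B_1|)\right)\end{pmatrix}.$$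 Then $\{\psi_{M_1,M_2,0,n}\}_{n\in\mathbb Z}$ is an orthonormal basis of $W_0$ if and only if $U\left(\frac{B_2u}{B_1}\right)U^*\left(\frac{B_2u}{B_1}\right)=I$ for almost every $u\in\mathbb R$. (2) For the choice $$d_k=(-1)^{1-k}\,\overline{c_{1-k}}\,e^{-\frac i2\left\{\frac{(1-k)^2A_1}{4B_1}+\frac{k^2A_1}{4B_1}+\frac4{B_1}\right\}},\qquad k\in\mathbb Z,$$ the series in (1) converges in $L^2(\mathbb R)$, and its sum $\psi$ is a wavelet: $\{\psi_{M_1,M_2,0,n}\}_{n\in\mathbb Z}$ is an orthonormal basis of $W_0$, and $\{\psi_{M_1,M_2,m,n}\}_{m,n\in\mathbb Z}$ is an orthonormal basis of $L^2(\mathbb R)$. -/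

import Mathlib

open MeasureTheory Complex
open scoped MatrixGroups ENNReal

noncomputable section

namespace LCWavelet

/-- The Hilbert space `L²(ℝ)` of complex-valued functions. -/
abbrev L2R : Type := Lp ℂ 2 (volume : Measure ℝ)

/-- `t ↦ r f(at - b) e^{iθ(t)}` is square integrable when `f` is. -/
theorem memLp_modulated (f : L2R) (r : ℂ) {a : ℝ} (ha : a ≠ 0) (b : ℝ) {θ : ℝ → ℝ}
    (hθ : Continuous θ) :
    MemLp (fun t : ℝ => r * f (a * t - b) * cexp (I / 2 * (θ t : ℂ))) 2 volume := by
  have h1 : MemLp (fun t : ℝ => f (a * t - b)) 2 volume := by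
    have hq : Measure.QuasiMeasurePreserving (fun t : ℝ => a * t - b) volume volume := by
      refine (measurePreserving_sub_right volume b).quasiMeasurePreserving.comp
        ⟨measurable_const_mul a, ?_⟩
      rw [Real.map_volume_mul_left ha]
      exact Measure.smul_absolutelyContinuous
    have hm : AEStronglyMeasurable (fun t : ℝ => f (a * t - b)) volume :=
      (Lp.aestronglyMeasurable f).comp_quasiMeasurePreserving hq
    rw [memLp_two_iff_integrable_sq_norm hm]
    have hi := (memLp_two_iff_integrable_sq_norm (Lp.aestronglyMeasurable f)).1 (Lp.memLp f)
    exact (hi.comp_sub_right b).comp_mul_left' ha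
  refine (h1.const_mul r).of_le (h1.1.const_mul r |>.mul ?_) (Filter.Eventually.of_forall ?_)
  · exact Continuous.aestronglyMeasurable (by fun_prop)
  · intro t
    have : ‖cexp (I / 2 * (θ t : ℂ))‖ = 1 := by
      rw [show I / 2 * (θ t : ℂ) = ((θ t / 2 : ℝ) : ℂ) * I by push_cast; ring]
      exact norm_exp_ofReal_mul_I _
    simp [this]

/-- `f(t) ↦ f(2t) e^{(iA₁/2B₁)((2t)² - t²)}`, with `M₁ = (A₁, B₁; C₁, D₁)`. -/
def chirpDilation (M₁ : SL(2, ℝ)) (f : L2R) : L2R :=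
  (memLp_modulated f 1 (two_ne_zero' ℝ) 0
    (θ := fun t => M₁ 0 0 / M₁ 0 1 * ((2 * t) ^ 2 - t ^ 2)) (by fun_prop)).toLp

/-- `φ_{M₁,M₂,m,n}(t) = 2^{m/2} φ(2^m t - n)
e^{-(i/2){(t² - (n/2^m)²) A₁/B₁ - (2^m t - n)² A₂/B₂ - 2(2^m t + n)/B₁}}`. -/
def family (M₁ M₂ : SL(2, ℝ)) (φ : L2R) (m n : ℤ) : L2R :=
  (memLp_modulated φ (((2 : ℝ) ^ ((m : ℝ) / 2) : ℝ) : ℂ)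
    (zpow_ne_zero m (two_ne_zero' ℝ)) (n : ℝ)
    (θ := fun t => -((t ^ 2 - ((n : ℝ) / 2 ^ m) ^ 2) * (M₁ 0 0 / M₁ 0 1)
      - (2 ^ m * t - n) ^ 2 * (M₂ 0 0 / M₂ 0 1)
      - 2 * (2 ^ m * t + n) / M₁ 0 1)) (by fun_prop)).toLp

/-- `t ↦ √2 φ(2t - n) e^{(i/2){n²A₁/(4B₁) + (3t² - 4tn + n²) A₂/B₂ + 2(t + n)/B₁}}`. -/
def atom (M₁ M₂ : SL(2, ℝ)) (φ : L2R) (n : ℤ) : L2R :=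
  (memLp_modulated φ ((√2 : ℝ) : ℂ) (two_ne_zero' ℝ) (n : ℝ)
    (θ := fun t => (n : ℝ) ^ 2 * M₁ 0 0 / (4 * M₁ 0 1)
      + (3 * t ^ 2 - 4 * t * n + (n : ℝ) ^ 2) * (M₂ 0 0 / M₂ 0 1)
      + 2 * (t + n) / M₁ 0 1) (by fun_prop)).toLp

/-- `e` is an orthonormal basis (in the Hilbert space sense) of the closed subspace `V`. -/
def IsONBOf {ι : Type*} (e : ι → L2R) (V : Submodule ℂ L2R) : Prop :=
  Orthonormal ℂ e ∧ (Submodule.span ℂ (Set.range e)).topologicalClosure = V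

/-- `V` is an orthogonal multiresolution analysis of `L²(ℝ)` associated with the linear canonical
Stockwell transform with parameters `M₁`, `M₂`, and `φ` is a scaling function for it. -/
structure IsOrthogonalMRA (M₁ M₂ : SL(2, ℝ)) (V : ℤ → Submodule ℂ L2R) (φ : L2R) : Prop where
  isClosed : ∀ m, IsClosed (V m : Set L2R)
  le_succ : ∀ m, V m ≤ V (m + 1)
  mem_iff_chirpDilation_mem : ∀ m (f : L2R), f ∈ V m ↔ chirpDilation M₁ f ∈ V (m + 1)
  iInter_eq : (⋂ m, (V m : Set L2R)) = {0}
  dense_iUnion : Dense (⋃ m, (V m : Set L2R))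
  scaling : IsONBOf (fun n : ℤ => family M₁ M₂ φ 0 n) (V 0)

/-- The wavelet space `W_k`: the orthogonal complement of `V_k` in `V_{k+1}`. -/
def waveletSpace (V : ℤ → Submodule ℂ L2R) (k : ℤ) : Submodule ℂ L2R :=
  (V k)ᗮ ⊓ V (k + 1)

/-- The coefficients `c_n = ⟨φ_{M₁,M₂,0,0}, φ_{M₁,M₂,1,n}⟩` of the scaling function
(Mathlib's inner product is conjugate-linear in its first argument). -/
def scalingCoeff (M₁ M₂ : SL(2, ℝ)) (φ : L2R) (n : ℤ) : ℂ :=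
  inner ℂ (family M₁ M₂ φ 1 n) (family M₁ M₂ φ 0 0)

instance fact_two_pi_pos : Fact ((0 : ℝ) < 2 * Real.pi) := ⟨Real.two_pi_pos⟩

/-- The symbol `u ↦ (√2/2) ∑ₙ aₙ e^{(i/2)(n²A₁/(4B₁) + 4n/B₁ - 2nu/B₂)}` of a square-summable
sequence `a`. The series converges in `L²` of a period: it is summed in `L²` of the circle
`ℝ / 2πℤ`, where `fourierLp 2 (-n)` is the class of `x ↦ e^{-inx}`, and taken at `x = u/B₂`. -/
def symbol (M₁ M₂ : SL(2, ℝ)) (a : ℤ → ℂ) (u : ℝ) : ℂ :=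
  ((√2 / 2 : ℝ) : ℂ) *
    (∑' n : ℤ,
      (a n * cexp (I / 2 *
        (((n : ℝ) ^ 2 * M₁ 0 0 / (4 * M₁ 0 1) + 4 * (n : ℝ) / M₁ 0 1 : ℝ) : ℂ))) •
        (fourierLp 2 (-n) :
          Lp ℂ 2 (AddCircle.haarAddCircle (T := 2 * Real.pi))))
      ((u / M₂ 0 1 : ℝ) : AddCircle (2 * Real.pi))

/-- The matrix `U(B₂u/B₁)`; its rows are the symbols `Λ` of `c` and `Γ` of `d`, each taken at
`B₂u/B₁` and at `(B₂/B₁)(u + π|B₁|)`. -/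
def symbolMatrix (M₁ M₂ : SL(2, ℝ)) (c d : ℤ → ℂ) (u : ℝ) : Matrix (Fin 2) (Fin 2) ℂ :=
  !![symbol M₁ M₂ c (M₂ 0 1 * u / M₁ 0 1),
      symbol M₁ M₂ c (M₂ 0 1 / M₁ 0 1 * (u + Real.pi * |M₁ 0 1|));
    symbol M₁ M₂ d (M₂ 0 1 * u / M₁ 0 1),
      symbol M₁ M₂ d (M₂ 0 1 / M₁ 0 1 * (u + Real.pi * |M₁ 0 1|))]

/-- `d_k = (-1)^{1-k} conj(c_{1-k}) e^{-(i/2){(1-k)²A₁/(4B₁) + k²A₁/(4B₁) + 4/B₁}}`. -/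
def mirrorCoeff (M₁ : SL(2, ℝ)) (c : ℤ → ℂ) (k : ℤ) : ℂ :=
  (-1) ^ (1 - k) * (starRingEnd ℂ) (c (1 - k)) *
    cexp (-(I / 2) *
      (((1 - (k : ℝ)) ^ 2 * M₁ 0 0 / (4 * M₁ 0 1) + (k : ℝ) ^ 2 * M₁ 0 0 / (4 * M₁ 0 1)
        + 4 / M₁ 0 1 : ℝ) : ℂ))

end LCWavelet

end

/-! The chirps are removed by unitary conjugation. Up to constants of modulus one, which do not
affect orthonormal bases, each `family` is a family `dilate`. The unitary `levelUp` raises its scale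
by one, and `chirpTranslate` shifts its index by `k` at scale 0 and by `2 * k` at scale 1. With `e n
= dilate M₁ M₂ 1 n φ`, an orthonormal basis of `V 1`, the translates of `φ` and `ψ` become `∑ p n •
e (n + 2k)` and `∑ q n • e (n + 2k)`, where `p`, `q` are the coefficients `c`, `d` times phases.

Orthogonality relations between translates say that the correlations `∑ conj (p n) * q (n - 2k)` are
`0` or `1`. These are the even Fourier coefficients of `conj F * G`, where `F`, `G` are the
functions on the circle with coefficients `p`, `q`. By uniqueness of Fourier coefficients in `L¹`
they prescribe the `π`-periodization of `conj F * G`, that is, an entry of `U U* = I`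
(`correlation_ae_eq_iff`, `hasSum_correlation_iff`).

For completeness in `W₀`, `U U* = I` implies `U* U = I`, and orthogonality of the columns integrates
to `∑ (-1)ⁿ (|p n|² + |q n|²) = 0`. The full sum is `2`, so the even and odd parts are both `1`.
This is Parseval's identity at every `e n` for the joint family of translates
(`inner_eq_zero_of_orthonormal_pair`).

For the mirror coefficients all these relations follow from reflections of the summation index.
Finally `levelUp` carries the basis of `W₀` to every `W_m`, and the `W_m` exhaust `L²(ℝ)`
(`eq_zero_of_orthogonal_differences`). -/

noncomputable section

namespace LCWavelet

open scoped ComplexConjugate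
open AddCircle

/-! ### Orthonormal expansions, and completeness criteria in Hilbert space. -/

section Hilbert

variable {ι E : Type*} [NormedAddCommGroup E] [InnerProductSpace ℂ E]

theorem inner_eq_of_hasSum {v : ι → E} (hv : Orthonormal ℂ v) {a : ι → ℂ} {x : E}
    (h : HasSum (fun n => a n • v n) x) (n : ι) : inner ℂ (v n) x = a n := by
  classical
  have h1 := h.mapL (innerSL ℂ (v n))
  simp only [innerSL_apply_apply, inner_smul_right, orthonormal_iff_ite.1 hv] at h1
  refine h1.unique ?_
  convert! hasSum_ite_eq n (a n) using 2 with m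
  by_cases hm : n = m
  · simp [hm]
  · simp [hm, Ne.symm hm]

theorem hasSum_inner_of_hasSum {v : ι → E} (hv : Orthonormal ℂ v) {a b : ι → ℂ} {x y : E}
    (hx : HasSum (fun n => a n • v n) x) (hy : HasSum (fun n => b n • v n) y) :
    HasSum (fun n => conj (a n) * b n) (inner ℂ x y) := by
  have h1 := hy.mapL (innerSL ℂ x)
  simp only [innerSL_apply_apply, inner_smul_right] at h1
  convert! h1 using 2 with n
  rw [← inner_conj_symm, inner_eq_of_hasSum hv hx, mul_comm]

theorem hasSum_norm_sq_of_hasSum {v : ι → E} (hv : Orthonormal ℂ v) {a : ι → ℂ} {x : E}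
    (hx : HasSum (fun n => a n • v n) x) : HasSum (fun n => ‖a n‖ ^ 2) (‖x‖ ^ 2) := by
  have h := hasSum_inner_of_hasSum hv hx hx
  simp only [conj_mul', inner_self_eq_norm_sq_to_K] at h
  rw [← Complex.hasSum_ofReal]
  simpa using h

theorem summable_smul_orthonormal [CompleteSpace E] {v : ι → E} (hv : Orthonormal ℂ v)
    {a : ι → ℂ} (ha : Summable fun n => ‖a n‖ ^ 2) : Summable fun n => a n • v n := by
  have := (hv.orthogonalFamily.summable_iff_norm_sq_summable a).2 ha
  simpa using this

/-- By Bessel the series converges to some `y`. Then `x - y` lies both in the closed span and in its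
orthogonal complement. -/
theorem hasSum_of_mem_closure_span [CompleteSpace E] {v : ι → E} (hv : Orthonormal ℂ v) {x : E}
    (hx : x ∈ (Submodule.span ℂ (Set.range v)).topologicalClosure) :
    HasSum (fun n => inner ℂ (v n) x • v n) x := by
  obtain ⟨y, hy⟩ := summable_smul_orthonormal hv (hv.inner_products_summable x)
  have hyK : y ∈ (Submodule.span ℂ (Set.range v)).topologicalClosure := by
    refine (Submodule.isClosed_topologicalClosure _).mem_of_tendsto hy
      (Filter.Eventually.of_forall fun s => ?_)
    exact Submodule.sum_mem _ fun i _ => Submodule.smul_mem _ _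
      (Submodule.le_topologicalClosure _ (Submodule.subset_span ⟨i, rfl⟩))
  have hort : x - y ∈ (Submodule.span ℂ (Set.range v))ᗮ := by
    rw [Submodule.mem_orthogonal]
    intro u hu
    induction hu using Submodule.span_induction with
    | mem u hu =>
      obtain ⟨n, rfl⟩ := hu
      rw [inner_sub_right, inner_eq_of_hasSum hv hy, sub_self]
    | zero => simp
    | add _ _ _ _ h1 h2 => rw [inner_add_left, h1, h2, add_zero]
    | smul c _ _ h => rw [inner_smul_left, h, mul_zero]
  rw [← Submodule.orthogonal_closure] at hort
  have h0 : inner ℂ (x - y) (x - y) = 0 :=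
    Submodule.inner_right_of_mem_orthogonal (Submodule.sub_mem _ hx hyK) hort
  rw [inner_self_eq_zero, sub_eq_zero] at h0
  rwa [← h0] at hy

theorem mem_closure_span_of_hasSum {v : ι → E} {a : ι → ℂ} {x : E}
    (h : HasSum (fun n => a n • v n) x) :
    x ∈ (Submodule.span ℂ (Set.range v)).topologicalClosure := by
  refine (Submodule.isClosed_topologicalClosure _).mem_of_tendsto h
    (Filter.Eventually.of_forall fun s => ?_)
  exact Submodule.sum_mem _ fun i _ => Submodule.smul_mem _ _
    (Submodule.le_topologicalClosure _ (Submodule.subset_span ⟨i, rfl⟩))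

theorem closure_span_eq_of_forall [CompleteSpace E] {v : ι → E} {K : Submodule ℂ E}
    (hK : IsClosed (K : Set E)) (hv : ∀ i, v i ∈ K)
    (h : ∀ w ∈ K, (∀ i, inner ℂ (v i) w = 0) → w = 0) :
    (Submodule.span ℂ (Set.range v)).topologicalClosure = K := by
  have hle : (Submodule.span ℂ (Set.range v)).topologicalClosure ≤ K :=
    Submodule.topologicalClosure_minimal _
      (Submodule.span_le.2 (by rintro _ ⟨i, rfl⟩; exact hv i)) hK
  refine le_antisymm hle fun w hw => ?_
  have : CompleteSpace (Submodule.span ℂ (Set.range v)).topologicalClosure :=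
    (Submodule.isClosed_topologicalClosure _).completeSpace_coe
  obtain ⟨y, hy, z, hz, rfl⟩ :=
    (Submodule.span ℂ (Set.range v)).topologicalClosure.exists_add_mem_mem_orthogonal w
  have hz0 : z = 0 := by
    refine h z ?_ fun i => ?_
    · simpa using Submodule.sub_mem _ hw (hle hy)
    · exact Submodule.inner_right_of_mem_orthogonal
        (Submodule.le_topologicalClosure _ (Submodule.subset_span (Set.mem_range_self i))) hz
  simpa [hz0] using hy

theorem eq_zero_of_inner_closure_span {v : ι → E} {K : Submodule ℂ E}
    (hv : (Submodule.span ℂ (Set.range v)).topologicalClosure = K) {w x : E}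
    (h : ∀ i, inner ℂ (v i) w = 0) (hx : x ∈ K) : inner ℂ x w = 0 := by
  have hort : w ∈ (Submodule.span ℂ (Set.range v))ᗮ := by
    rw [Submodule.mem_orthogonal]
    intro u hu
    induction hu using Submodule.span_induction with
    | mem u hu => obtain ⟨n, rfl⟩ := hu; exact h n
    | zero => simp
    | add _ _ _ _ h1 h2 => rw [inner_add_left, h1, h2, add_zero]
    | smul c _ _ h => rw [inner_smul_left, h, mul_zero]
  rw [← Submodule.orthogonal_closure, hv] at hort
  exact Submodule.inner_right_of_mem_orthogonal hx hort

/-- If Parseval's identity holds at `x` for an orthonormal family, then every vector orthogonal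
to the family is orthogonal to `x`. -/
theorem inner_eq_zero_of_parseval {v : ι → E} (hv : Orthonormal ℂ v) {x w : E}
    (hx : HasSum (fun i => ‖inner ℂ (v i) x‖ ^ 2) (‖x‖ ^ 2))
    (hw : ∀ i, inner ℂ (v i) w = 0) : inner ℂ x w = 0 := by
  by_contra hne
  have hw0 : w ≠ 0 := by rintro rfl; simp at hne
  have hn : (0 : ℝ) < ‖w‖ := norm_pos_iff.2 hw0
  set w' : E := ((‖w‖⁻¹ : ℝ) : ℂ) • w with hw'
  have hw'1 : ‖w'‖ = 1 := by
    rw [hw', norm_smul]; simp [hn.ne']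
  -- Adjoin the normalized `w` to the family. Bessel's inequality for the larger family leaves no
  -- room for a component of `x` along `w`, since Parseval already exhausts `‖x‖ ^ 2`.
  let V : Option ι → E := fun o => o.elim w' v
  have hV : Orthonormal ℂ V := by
    refine ⟨?_, ?_⟩
    · rintro (_ | i)
      · exact hw'1
      · exact hv.1 i
    · rintro (_ | i) (_ | j) hij
      · exact absurd rfl hij
      · change inner ℂ w' (v j) = 0
        rw [hw', inner_smul_left, ← inner_conj_symm, hw]; simp
      · change inner ℂ (v i) w' = 0
        rw [hw', inner_smul_right, hw, mul_zero]
      · exact hv.2 (fun h => hij (by rw [h]))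
  have hb : ∀ s : Finset ι, ∑ i ∈ s, ‖inner ℂ (v i) x‖ ^ 2 ≤ ‖x‖ ^ 2 - ‖inner ℂ w' x‖ ^ 2 := by
    intro s
    have := hV.sum_inner_products_le x (s := Finset.insertNone s)
    rw [Finset.sum_insertNone] at this
    change ‖inner ℂ w' x‖ ^ 2 + ∑ i ∈ s, ‖inner ℂ (v i) x‖ ^ 2 ≤ _ at this
    linarith
  have hle := hasSum_le_of_sum_le hx hb
  have h0 : ‖inner ℂ w' x‖ ^ 2 ≤ 0 := by linarith
  have h1 : inner ℂ w' x = 0 := by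
    have := pow_eq_zero_iff (two_ne_zero) |>.1 (le_antisymm h0 (sq_nonneg _))
    exact norm_eq_zero.1 this
  rw [hw', inner_smul_left, mul_eq_zero] at h1
  rcases h1 with h1 | h1
  · simp [hn.ne'] at h1
  · exact hne (by rw [← inner_conj_symm, h1, map_zero])

variable {e : ℤ → E} {p q : ℤ → ℂ} {f g : ℤ → E}

theorem hasSum_reindex (h : ∀ k, HasSum (fun n => p n • e (n + 2 * k)) (f k)) (k : ℤ) :
    HasSum (fun n => p (n - 2 * k) • e n) (f k) := by
  rw [← (Equiv.addRight (2 * k)).hasSum_iff]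
  convert! h k using 2 with n
  simp

theorem hasSum_correlation (he : Orthonormal ℂ e)
    (hf : ∀ k, HasSum (fun n => p n • e (n + 2 * k)) (f k))
    (hg : ∀ k, HasSum (fun n => q n • e (n + 2 * k)) (g k)) (j k : ℤ) :
    HasSum (fun n => conj (p n) * q (n - 2 * (k - j))) (inner ℂ (f j) (g k)) := by
  have := hasSum_inner_of_hasSum he (hasSum_reindex hf j) (hasSum_reindex hg k)
  rw [← (Equiv.addRight (2 * j)).hasSum_iff] at this
  convert! this using 2 with n
  simp only [Function.comp_apply, Equiv.coe_addRight, add_sub_cancel_right]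
  congr 2
  ring

/-- The coefficients of `e n` along `f k` and `g k` have moduli `|p (n - 2k)|` and `|q (n - 2k)|`,
so they only see indices of the parity of `n`. The total over all indices is `2` and the alternating
sum is `0`, hence each parity class contributes `1 = ‖e n‖ ^ 2`, which is Parseval at `e n`. -/
theorem inner_eq_zero_of_orthonormal_pair (he : Orthonormal ℂ e)
    (hf : ∀ k, HasSum (fun n => p n • e (n + 2 * k)) (f k))
    (hg : ∀ k, HasSum (fun n => q n • e (n + 2 * k)) (g k))
    (hfo : Orthonormal ℂ f) (hgo : Orthonormal ℂ g) (hfg : ∀ j k, inner ℂ (f j) (g k) = 0)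
    (hpar : HasSum (fun n : ℤ => (-1 : ℝ) ^ n * (‖p n‖ ^ 2 + ‖q n‖ ^ 2)) 0)
    {w : E} (hfw : ∀ k, inner ℂ (f k) w = 0) (hgw : ∀ k, inner ℂ (g k) w = 0) (n : ℤ) :
    inner ℂ (e n) w = 0 := by
  have hv : Orthonormal ℂ (Sum.elim f g) := by
    refine ⟨?_, ?_⟩
    · rintro (i | i)
      · exact hfo.1 i
      · exact hgo.1 i
    · rintro (i | i) (j | j) hij
      · exact hfo.2 (fun h => hij (by rw [h]))
      · exact hfg i j
      · change inner ℂ (g i) (f j) = 0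
        rw [← inner_conj_symm, hfg, map_zero]
      · exact hgo.2 (fun h => hij (by rw [h]))
  refine inner_eq_zero_of_parseval hv ?_ (by rintro (i | i) <;> simp [hfw, hgw])
  have hp := hasSum_norm_sq_of_hasSum he (by simpa using hf 0)
  have hq := hasSum_norm_sq_of_hasSum he (by simpa using hg 0)
  rw [hfo.1] at hp
  rw [hgo.1] at hq
  -- Half of the total plus `(-1) ^ n` times the alternating sum: terms of the parity of `n` are
  -- kept, the others cancel, and the value is `1`.
  have hcomb := ((hp.add hq).add (hpar.mul_left ((-1 : ℝ) ^ n))).mul_left (1 / 2)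
  have hinj : Function.Injective fun k : ℤ => n - 2 * k := fun a b h => by
    simp only at h; omega
  rw [← hinj.hasSum_iff] at hcomb
  · have key : HasSum (fun k : ℤ => ‖p (n - 2 * k)‖ ^ 2 + ‖q (n - 2 * k)‖ ^ 2) 1 := by
      convert! hcomb using 2 with k
      · have : (-1 : ℝ) ^ n * (-1) ^ (n - 2 * k) = 1 := by
          rw [← zpow_add₀ (by norm_num), show n + (n - 2 * k) = 2 * (n - k) by ring, zpow_mul]
          simp
        simp only [Function.comp_apply]
        rw [← mul_assoc, this]; ring
      · norm_num
    have hsp : Summable fun k : ℤ => ‖p (n - 2 * k)‖ ^ 2 := hp.summable.comp_injective hinj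
    have hsq : Summable fun k : ℤ => ‖q (n - 2 * k)‖ ^ 2 := hq.summable.comp_injective hinj
    have hs := HasSum.sum (f := fun i : ℤ ⊕ ℤ => ‖inner ℂ (Sum.elim f g i) (e n)‖ ^ 2)
      (a := ∑' k : ℤ, ‖p (n - 2 * k)‖ ^ 2) (b := ∑' k : ℤ, ‖q (n - 2 * k)‖ ^ 2) ?_ ?_
    · rw [he.1, one_pow]
      rwa [(hsp.hasSum.add hsq.hasSum).unique key] at hs
    · convert! hsp.hasSum using 2 with k
      simp only [Function.comp_apply, Sum.elim_inl]
      rw [norm_inner_symm, inner_eq_of_hasSum he (hasSum_reindex hf k)]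
    · convert! hsq.hasSum using 2 with k
      simp only [Function.comp_apply, Sum.elim_inr]
      rw [norm_inner_symm, inner_eq_of_hasSum he (hasSum_reindex hg k)]
  · intro m hm
    have hodd : Odd (n + m) := by
      by_contra hcon
      rw [Int.not_odd_iff_even] at hcon
      obtain ⟨r, hr⟩ := hcon
      exact hm ⟨n - r, by simp only; omega⟩
    have : (-1 : ℝ) ^ n * (-1) ^ m = -1 := by
      rw [← zpow_add₀ (by norm_num), hodd.neg_one_zpow]
    rw [← mul_assoc, this]; ring

/-- A vector orthogonal to all the differences of an increasing, exhausting and separated chain of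
closed subspaces vanishes. -/
theorem eq_zero_of_orthogonal_differences [CompleteSpace E] {V : ℤ → Submodule ℂ E}
    (hcl : ∀ m, IsClosed (V m : Set E)) (hle : ∀ m, V m ≤ V (m + 1))
    (hinter : (⋂ m, (V m : Set E)) = {0}) (hdense : Dense (⋃ m, (V m : Set E))) {w : E}
    (hw : ∀ m, ∀ x ∈ (V m)ᗮ ⊓ V (m + 1), inner ℂ x w = 0) : w = 0 := by
  have : ∀ m, CompleteSpace (V m) := fun m => (hcl m).completeSpace_coe
  have hdec := fun m => (V m).exists_add_mem_mem_orthogonal w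
  choose y hy z hz hyz using hdec
  -- `y m` is the projection of `w` on `V m`. The increment `y (m + 1) - y m` lies in the difference
  -- space, so it is orthogonal to `w`, to `z (m + 1)` and to `y m`, hence to itself. The
  -- projections are therefore constant, and lie in the trivial intersection.
  have hstep : ∀ m, y (m + 1) = y m := by
    intro m
    have hx : y (m + 1) - y m = z m - z (m + 1) := by
      rw [sub_eq_sub_iff_add_eq_add, ← hyz (m + 1), add_comm, ← hyz m]
    have hz' : z (m + 1) ∈ (V m)ᗮ := Submodule.orthogonal_le (hle m) (hz (m + 1))
    have hxo : y (m + 1) - y m ∈ (V m)ᗮ := hx ▸ Submodule.sub_mem _ (hz m) hz'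
    have hxV : y (m + 1) - y m ∈ V (m + 1) :=
      Submodule.sub_mem _ (hy _) (hle m (hy m))
    have h1 := hw m _ ⟨hxo, hxV⟩
    have h2 : inner ℂ (y (m + 1) - y m) (z (m + 1)) = 0 :=
      Submodule.inner_right_of_mem_orthogonal hxV (hz _)
    have h3 : inner ℂ (y (m + 1) - y m) (y m) = 0 :=
      Submodule.inner_left_of_mem_orthogonal (hy m) hxo
    have h4 : inner ℂ (y (m + 1) - y m) (y (m + 1) - y m) = 0 := by
      rw [inner_sub_right _ (y (m + 1)) (y m), h3, sub_zero]
      rw [hyz (m + 1), inner_add_right, h2, add_zero] at h1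
      exact h1
    exact sub_eq_zero.1 (inner_self_eq_zero.1 h4)
  have hconst : ∀ m, y m = y 0 := by
    intro m
    induction m using Int.induction_on with
    | zero => rfl
    | succ i ih => rw [hstep, ih]
    | pred i ih => rw [← hstep, sub_add_cancel, ih]
  have hy0 : y 0 = 0 := by
    have : y 0 ∈ ⋂ m, (V m : Set E) := Set.mem_iInter.2 fun m => by
      rw [← hconst m]; exact hy m
    rwa [hinter] at this
  refine hdense.eq_zero_of_inner_right ℂ fun v hv => ?_
  obtain ⟨m, hm⟩ := Set.mem_iUnion.1 hv
  rw [hyz m, hconst, hy0, zero_add]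
  exact Submodule.inner_right_of_mem_orthogonal hm (hz m)

end Hilbert

/-! ### Orthogonality relations for mirror coefficients. -/

section Mirror

variable {E : Type*} [NormedAddCommGroup E] [InnerProductSpace ℂ E]
variable {e : ℤ → E} {p q : ℤ → ℂ} {f g : ℤ → E}

/-- The substitution `n ↦ 1 - n` matches the two series: the signs multiply to an even power of
`-1`, and the conjugation in `hq` exchanges the two factors. -/
theorem inner_mirror (he : Orthonormal ℂ e)
    (hf : ∀ k, HasSum (fun n => p n • e (n + 2 * k)) (f k))
    (hg : ∀ k, HasSum (fun n => q n • e (n + 2 * k)) (g k))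
    (hq : ∀ n, q n = (-1) ^ (1 - n) * conj (p (1 - n))) (j k : ℤ) :
    inner ℂ (g j) (g k) = inner ℂ (f (-k)) (f (-j)) := by
  have h1 := hasSum_inner_of_hasSum he (hasSum_reindex hg j) (hasSum_reindex hg k)
  have h2 := hasSum_inner_of_hasSum he (hasSum_reindex hf (-k)) (hasSum_reindex hf (-j))
  rw [← (Equiv.subLeft (1 : ℤ)).hasSum_iff] at h2
  refine h1.unique ?_
  convert! h2 using 2 with n
  simp only [Function.comp_apply, Equiv.subLeft_apply, hq]
  have hs : conj ((-1 : ℂ) ^ (1 - (n - 2 * j))) * (-1) ^ (1 - (n - 2 * k)) = 1 := by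
    rw [map_zpow₀, map_neg, map_one, ← zpow_add₀ (by norm_num),
      show 1 - (n - 2 * j) + (1 - (n - 2 * k)) = 2 * (1 - n + j + k) by ring, zpow_mul]
    simp
  rw [map_mul, Complex.conj_conj, show 1 - n - 2 * -k = 1 - (n - 2 * k) by ring,
    show 1 - n - 2 * -j = 1 - (n - 2 * j) by ring]
  linear_combination (p (1 - (n - 2 * j)) * conj (p (1 - (n - 2 * k)))) * hs

/-- The reflection `n ↦ 1 + 2j + 2k - n` exchanges the two factors `conj p` in each term and
reverses the sign, so the sum equals its own negative. -/
theorem inner_mirror_eq_zero (he : Orthonormal ℂ e)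
    (hf : ∀ k, HasSum (fun n => p n • e (n + 2 * k)) (f k))
    (hg : ∀ k, HasSum (fun n => q n • e (n + 2 * k)) (g k))
    (hq : ∀ n, q n = (-1) ^ (1 - n) * conj (p (1 - n))) (j k : ℤ) :
    inner ℂ (f j) (g k) = 0 := by
  have h1 := hasSum_inner_of_hasSum he (hasSum_reindex hf j) (hasSum_reindex hg k)
  have h2 := h1
  rw [← (Equiv.subLeft (1 + 2 * j + 2 * k : ℤ)).hasSum_iff] at h2
  have h3 : inner ℂ (f j) (g k) = -inner ℂ (f j) (g k) := by
    refine h2.unique ?_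
    convert! h1.neg using 2 with n
    simp only [Function.comp_apply, Equiv.subLeft_apply, hq]
    have hs : (-1 : ℂ) ^ (1 - (1 + 2 * j + 2 * k - n - 2 * k)) = -(-1) ^ (1 - (n - 2 * k)) := by
      rw [show 1 - (1 + 2 * j + 2 * k - n - 2 * k) = (1 - (n - 2 * k)) + (2 * (n - j - k) - 1) by
        ring, zpow_add₀ (by norm_num), zpow_sub₀ (by norm_num) (2 * (n - j - k)), zpow_mul]
      simp
    rw [hs, show 1 + 2 * j + 2 * k - n - 2 * j = 1 - (n - 2 * k) by ring,
      show 1 - (1 + 2 * j + 2 * k - n - 2 * k) = n - 2 * j by ring]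
    ring
  exact self_eq_neg.1 h3

/-- The reflection `n ↦ 1 - n` changes parity, so the alternating sum of `‖q n‖ ^ 2` is the negative
of that of `‖p n‖ ^ 2`. -/
theorem hasSum_mirror_alternating (hp : Summable fun n => ‖p n‖ ^ 2)
    (hq : ∀ n, q n = (-1) ^ (1 - n) * conj (p (1 - n))) :
    HasSum (fun n : ℤ => (-1 : ℝ) ^ n * (‖p n‖ ^ 2 + ‖q n‖ ^ 2)) 0 := by
  have hs : Summable fun n : ℤ => (-1 : ℝ) ^ n * ‖p n‖ ^ 2 := by
    refine Summable.of_norm ?_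
    simpa using hp
  obtain ⟨s, hs⟩ := hs
  have h2 := hs
  rw [← (Equiv.subLeft (1 : ℤ)).hasSum_iff] at h2
  convert! hs.sub h2 using 2 with n
  · simp only [Function.comp_apply, Equiv.subLeft_apply, hq, norm_mul, norm_zpow, norm_neg,
      norm_one, one_zpow, one_mul, RCLike.norm_conj]
    rw [zpow_sub₀ (by norm_num), zpow_one, neg_div, one_div, ← inv_zpow, inv_neg_one]
    ring
  · simp

end Mirror

/-! ### Uniqueness of Fourier coefficients for integrable functions on the circle. -/

section Uniqueness

variable {T : ℝ} [hT : Fact (0 < T)]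

/-- Integration against `f` is a continuous functional on `C(AddCircle T, ℂ)` that kills
trigonometric polynomials, which are dense. The `L¹` setting matters: a product of two `L²`
functions need not be in `L²`, so the `L²` Fourier basis does not suffice. -/
theorem integral_continuousMap_mul_eq_zero {f : AddCircle T → ℂ}
    (hf : Integrable f haarAddCircle)
    (h : ∀ n : ℤ, ∫ x, fourier n x * f x ∂haarAddCircle = 0) (g : C(AddCircle T, ℂ)) :
    ∫ x, g x * f x ∂haarAddCircle = 0 := by
  have hint : ∀ g : C(AddCircle T, ℂ), Integrable (fun x => g x * f x) haarAddCircle := fun g =>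
    hf.bdd_mul g.continuous.aestronglyMeasurable
      (Filter.Eventually.of_forall fun x => g.norm_coe_le_norm x)
  let Λ : C(AddCircle T, ℂ) →L[ℂ] ℂ := LinearMap.mkContinuous
    { toFun := fun g => ∫ x, g x * f x ∂haarAddCircle
      map_add' := fun g₁ g₂ => by
        simp only [ContinuousMap.add_apply, add_mul]
        exact integral_add (hint g₁) (hint g₂)
      map_smul' := fun c g => by
        simp only [ContinuousMap.smul_apply, smul_eq_mul, mul_assoc, RingHom.id_apply]
        exact integral_const_mul _ _ }
    (∫ x, ‖f x‖ ∂haarAddCircle) (fun g => by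
      change ‖∫ x, g x * f x ∂haarAddCircle‖ ≤ _
      rw [mul_comm, ← integral_const_mul]
      refine norm_integral_le_of_norm_le (hf.norm.const_mul _)
        (Filter.Eventually.of_forall fun x => ?_)
      rw [norm_mul]
      exact mul_le_mul_of_nonneg_right (g.norm_coe_le_norm x) (norm_nonneg _))
  have hle : (Submodule.span ℂ (Set.range (@fourier T))).topologicalClosure ≤ Λ.ker := by
    refine Submodule.topologicalClosure_minimal _ (Submodule.span_le.2 ?_) Λ.isClosed_ker
    rintro _ ⟨n, rfl⟩
    exact h n
  rw [span_fourier_closure_eq_top] at hle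
  exact hle (Submodule.mem_top (x := g))

/-- An integrable function on the circle whose Fourier coefficients all vanish is zero almost
everywhere. -/
theorem ae_eq_zero_of_integral_fourier_mul {f : AddCircle T → ℂ}
    (hf : Integrable f haarAddCircle)
    (h : ∀ n : ℤ, ∫ x, fourier n x * f x ∂haarAddCircle = 0) :
    f =ᵐ[haarAddCircle] 0 := by
  refine ae_eq_zero_of_forall_setIntegral_isClosed_eq_zero hf fun s hs => ?_
  -- The indicator of a closed set is a pointwise limit of continuous functions with values in `[0,
  -- 1]`, so dominated convergence passes from continuous multipliers to closed sets.
  have hz : ∀ n : ℕ, ∫ x, (((hs.apprSeq n x : NNReal) : ℝ) : ℂ) * f x ∂haarAddCircle = 0 :=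
    fun n => integral_continuousMap_mul_eq_zero hf h
      ⟨fun x => (((hs.apprSeq n x : NNReal) : ℝ) : ℂ), by fun_prop⟩
  have hlim : Filter.Tendsto
      (fun n : ℕ => ∫ x, (((hs.apprSeq n x : NNReal) : ℝ) : ℂ) * f x ∂haarAddCircle)
      Filter.atTop (nhds (∫ x, s.indicator f x ∂haarAddCircle)) := by
    refine tendsto_integral_of_dominated_convergence (fun x => ‖f x‖) (fun n => ?_) hf.norm
      (fun n => Filter.Eventually.of_forall fun x => ?_)
      (Filter.Eventually.of_forall fun x => ?_)
    · exact (Continuous.aestronglyMeasurable (by fun_prop)).mul hf.aestronglyMeasurable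
    · rw [norm_mul]
      refine mul_le_of_le_one_left (norm_nonneg _) ?_
      rw [Complex.norm_real, Real.norm_of_nonneg (NNReal.coe_nonneg _)]
      exact_mod_cast HasOuterApproxClosed.apprSeq_apply_le_one hs n x
    · have h1 := tendsto_pi_nhds.1 (HasOuterApproxClosed.tendsto_apprSeq hs) x
      have h2 : Filter.Tendsto (fun n : ℕ => (((hs.apprSeq n x : NNReal) : ℝ) : ℂ)) Filter.atTop
          (nhds (((s.indicator (fun _ => (1 : NNReal)) x : NNReal) : ℝ) : ℂ)) :=
        ((Complex.continuous_ofReal.comp NNReal.continuous_coe).tendsto _).comp h1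
      convert! h2.mul_const (f x) using 2
      by_cases hx : x ∈ s <;> simp [hx]
  rw [← integral_indicator hs.measurableSet]
  exact tendsto_nhds_unique hlim (by simp only [hz]; exact tendsto_const_nhds)

end Uniqueness

/-! ### Square integrable functions on the circle and the half turn. -/

/-- The circle of length `2π`. -/
abbrev Circ : Type := AddCircle (2 * Real.pi)

/-- Square integrable functions on the circle of length `2π`. -/
abbrev L2C : Type := Lp ℂ 2 (haarAddCircle (T := 2 * Real.pi))

/-- The point of the circle opposite to the origin. -/
def halfTurn : Circ := ((Real.pi : ℝ) : AddCircle (2 * Real.pi))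

theorem fourier_add_pi (n : ℤ) (x : Circ) :
    fourier n (x + halfTurn) = (-1 : ℂ) ^ n * fourier n x := by
  have h : fourier n halfTurn = (-1 : ℂ) ^ n := by
    rw [halfTurn, fourier_coe_apply, ← Complex.exp_pi_mul_I, ← Complex.exp_int_mul]
    congr 1
    push_cast
    field_simp
  rw [fourier_apply, smul_add, toCircle_add, Circle.coe_mul, ← fourier_apply, ← fourier_apply, h,
    mul_comm]

theorem inner_L2C (F G : L2C) : inner ℂ F G = ∫ x, conj (F x) * G x ∂haarAddCircle := by
  rw [L2.inner_def]
  simp only [RCLike.inner_apply']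

theorem integrable_conj_mul (F G : L2C) :
    Integrable (fun x => conj (F x) * G x) haarAddCircle := by
  have := L2.integrable_inner (𝕜 := ℂ) F G
  simpa only [RCLike.inner_apply'] using this

theorem inner_fourierLp (n : ℤ) (F : L2C) :
    inner ℂ (fourierLp 2 n) F = ∫ x, fourier (-n) x * F x ∂haarAddCircle := by
  rw [inner_L2C]
  refine integral_congr_ae ?_
  filter_upwards [coeFn_fourierLp (T := 2 * Real.pi) 2 n] with x hx
  rw [hx, fourier_neg]

theorem memLp_fourier_mul (m : ℤ) (F : L2C) :
    MemLp (fun x => fourier m x * F x) 2 haarAddCircle := by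
  refine (Lp.memLp F).of_le
    ((fourier m).continuous.aestronglyMeasurable.mul (Lp.aestronglyMeasurable F))
    (Filter.Eventually.of_forall fun x => ?_)
  rw [norm_mul, fourier_apply, Circle.norm_coe, one_mul]

theorem measurePreserving_add_pi :
    MeasurePreserving (fun x : Circ => x + halfTurn) haarAddCircle haarAddCircle :=
  measurePreserving_add_right _ _

theorem memLp_add_pi (F : L2C) :
    MemLp (fun x => F (x + halfTurn)) 2 haarAddCircle :=
  (Lp.memLp F).comp_measurePreserving measurePreserving_add_pi

theorem integral_comp_add_pi (h : Circ → ℂ) :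
    ∫ x, h (x + halfTurn) ∂haarAddCircle = ∫ x, h x ∂haarAddCircle :=
  integral_add_right_eq_self h _

/-! ### Correlation sums as Fourier coefficients of a periodization. -/

section Correlation

variable {F G : L2C} {p q : ℤ → ℂ}

theorem orthonormal_fourierLp_neg :
    Orthonormal ℂ (fun n : ℤ => (fourierLp 2 (-n) : L2C)) :=
  orthonormal_fourier.comp _ neg_injective

theorem inner_fourierLp_of_hasSum (hF : HasSum (fun n => p n • (fourierLp 2 (-n) : L2C)) F)
    (n : ℤ) : inner ℂ (fourierLp 2 n) F = p (-n) := by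
  simpa using inner_eq_of_hasSum orthonormal_fourierLp_neg hF (-n)

theorem hasSum_inner_fourierLp (F G : L2C) :
    HasSum (fun n : ℤ => conj (inner ℂ (fourierLp 2 (-n)) F) * inner ℂ (fourierLp 2 (-n)) G)
      (inner ℂ F G) := by
  have := (fourierBasis (T := 2 * Real.pi)).hasSum_inner_mul_inner F G
  rw [← (Equiv.neg ℤ).hasSum_iff] at this
  convert! this using 2 with n
  simp [coe_fourierBasis]

/-- Parseval for `F` and `fourier (-m) * G`: multiplication by a character shifts the coefficients
of `G` by `m`. -/
theorem hasSum_integral_fourier (hF : HasSum (fun n => p n • (fourierLp 2 (-n) : L2C)) F)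
    (hG : HasSum (fun n => q n • (fourierLp 2 (-n) : L2C)) G) (m : ℤ) :
    HasSum (fun n => conj (p n) * q (n - m))
      (∫ x, fourier (-m) x * (conj (F x) * G x) ∂haarAddCircle) := by
  have h := hasSum_inner_fourierLp F (memLp_fourier_mul (-m) G).toLp
  convert! h using 2 with n
  · rw [inner_fourierLp_of_hasSum hF, neg_neg]
    congr 1
    rw [inner_fourierLp]
    have h1 : q (n - m) = inner ℂ (fourierLp 2 (m - n)) G := by
      rw [inner_fourierLp_of_hasSum hG, neg_sub]
    rw [h1, inner_fourierLp]
    refine integral_congr_ae ?_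
    filter_upwards [(memLp_fourier_mul (-m) G).coeFn_toLp] with x hx
    rw [hx, ← mul_assoc, ← fourier_add]
    congr 3
    ring
  · rw [inner_L2C]
    refine integral_congr_ae ?_
    filter_upwards [(memLp_fourier_mul (-m) G).coeFn_toLp] with x hx
    rw [hx]
    ring

/-- Parseval for `F` and its half turn, whose coefficients are those of `F` times `(-1) ^ n`. -/
theorem hasSum_integral_add_pi (hF : HasSum (fun n => p n • (fourierLp 2 (-n) : L2C)) F) :
    HasSum (fun n : ℤ => ((((-1 : ℝ) ^ n * ‖p n‖ ^ 2 : ℝ)) : ℂ))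
      (∫ x, conj (F x) * F (x + halfTurn) ∂haarAddCircle) := by
  have h := hasSum_inner_fourierLp F (memLp_add_pi F).toLp
  convert! h using 2 with n
  · rw [inner_fourierLp_of_hasSum hF, neg_neg, inner_fourierLp, neg_neg]
    have h1 : inner ℂ (fourierLp 2 (-n)) F = p n := by
      rw [inner_fourierLp_of_hasSum hF, neg_neg]
    rw [inner_fourierLp, neg_neg, ← integral_comp_add_pi] at h1
    simp only [fourier_add_pi, mul_assoc] at h1
    rw [integral_const_mul] at h1
    have h2 : ∫ x, fourier n x * ((memLp_add_pi F).toLp : L2C) x ∂haarAddCircle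
        = ∫ x, fourier n x * F (x + halfTurn) ∂haarAddCircle := by
      refine integral_congr_ae ?_
      filter_upwards [(memLp_add_pi F).coeFn_toLp] with x hx
      rw [hx]
    rw [h2]
    have h3 : (-1 : ℂ) ^ n * (-1) ^ n = 1 := by
      rw [← mul_zpow]; simp
    have h4 : conj (p n) * p n = ((‖p n‖ ^ 2 : ℝ) : ℂ) := by
      rw [conj_mul']; push_cast; rfl
    push_cast at h4 ⊢
    rw [← h4]
    set J := ∫ x, fourier n x * F (x + halfTurn) ∂haarAddCircle
    linear_combination (-((-1 : ℂ) ^ n * conj (p n))) * h1 + conj (p n) * J * h3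
  · rw [inner_L2C]
    refine integral_congr_ae ?_
    filter_upwards [(memLp_add_pi F).coeFn_toLp] with x hx
    rw [hx]

/-- The `π`-periodization of `conj F * G`. -/
def correlation (F G : L2C) (x : Circ) : ℂ :=
  conj (F x) * G x + conj (F (x + halfTurn)) * G (x + halfTurn)

theorem integrable_conj_mul_add_pi (F G : L2C) :
    Integrable (fun x => conj (F (x + halfTurn)) * G (x + halfTurn)) haarAddCircle :=
  (measurePreserving_add_pi.integrable_comp
    (integrable_conj_mul F G).aestronglyMeasurable).2 (integrable_conj_mul F G)

theorem integrable_correlation (F G : L2C) : Integrable (correlation F G) haarAddCircle :=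
  (integrable_conj_mul F G).add (integrable_conj_mul_add_pi F G)

/-- The half turn preserves the measure and multiplies `fourier m` by `(-1) ^ m`. Periodization thus
doubles the even coefficients and kills the odd ones. -/
theorem integral_fourier_mul_correlation (F G : L2C) (m : ℤ) :
    ∫ x, fourier m x * correlation F G x ∂haarAddCircle
      = (1 + (-1) ^ m) * ∫ x, fourier m x * (conj (F x) * G x) ∂haarAddCircle := by
  have hb : ∀ f : Circ → ℂ, Integrable f haarAddCircle →
      Integrable (fun x => fourier m x * f x) haarAddCircle := fun f hf =>
    hf.bdd_mul (c := 1) (fourier m).continuous.aestronglyMeasurable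
      (Filter.Eventually.of_forall fun x => by rw [fourier_apply, Circle.norm_coe])
  simp only [correlation, mul_add]
  rw [integral_add (hb _ (integrable_conj_mul F G)) (hb _ (integrable_conj_mul_add_pi F G)),
    add_mul, one_mul]
  congr 1
  rw [← integral_comp_add_pi fun x => fourier m x * (conj (F x) * G x), ← integral_const_mul]
  refine integral_congr_ae (Filter.Eventually.of_forall fun x => ?_)
  have h3 : (-1 : ℂ) ^ m * (-1) ^ m = 1 := by
    rw [← mul_zpow]; simp
  simp only [fourier_add_pi]
  linear_combination (-(fourier m x * (conj (F (x + halfTurn)) * G (x + halfTurn)))) * h3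

theorem integral_fourier_const (m : ℤ) (c : ℂ) :
    ∫ x : Circ, fourier m x * c ∂haarAddCircle = if m = 0 then c else 0 := by
  rw [integral_mul_const]
  have h := orthonormal_iff_ite.1 (orthonormal_fourier (T := 2 * Real.pi)) (-m) 0
  rw [inner_fourierLp] at h
  have h2 : ∫ x, fourier (- -m) x * (fourierLp 2 0 : L2C) x ∂haarAddCircle
      = ∫ x : Circ, fourier m x ∂haarAddCircle := by
    refine integral_congr_ae ?_
    filter_upwards [coeFn_fourierLp (T := 2 * Real.pi) 2 0] with x hx
    rw [hx, fourier_zero, mul_one, neg_neg]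
  rw [← h2, h]
  simp [neg_eq_zero]

/-- Odd coefficients vanish on both sides, so only the even frequencies carry a condition. The
factor `2` in `2 * c` is the doubling of these by the periodization. -/
theorem correlation_ae_eq_iff (hF : HasSum (fun n => p n • (fourierLp 2 (-n) : L2C)) F)
    (hG : HasSum (fun n => q n • (fourierLp 2 (-n) : L2C)) G) (c : ℂ) :
    (∀ᵐ x ∂haarAddCircle, correlation F G x = 2 * c) ↔
      ∀ k : ℤ, HasSum (fun n => conj (p n) * q (n - 2 * k)) (if k = 0 then c else 0) := by
  constructor
  · intro h k
    have h1 := hasSum_integral_fourier hF hG (2 * k)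
    have h2 := integral_fourier_mul_correlation F G (-(2 * k))
    have h3 : ∫ x, fourier (-(2 * k)) x * correlation F G x ∂haarAddCircle
        = ∫ x : Circ, fourier (-(2 * k)) x * (2 * c) ∂haarAddCircle := by
      refine integral_congr_ae ?_
      filter_upwards [h] with x hx
      rw [hx]
    have hs : (-1 : ℂ) ^ (-(2 * k)) = 1 := by
      rw [show -(2 * k) = 2 * (-k) by ring, zpow_mul]; simp
    rw [h3, integral_fourier_const, hs] at h2
    convert! h1 using 1
    have h4 : (-(2 * k) = 0) ↔ k = 0 := by omega
    simp only [h4] at h2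
    split_ifs at h2 ⊢
    · linear_combination (1 / 2) * h2
    · linear_combination (1 / 2) * h2
  · intro h
    have h0 := ae_eq_zero_of_integral_fourier_mul
      (f := fun x => correlation F G x - 2 * c)
      ((integrable_correlation F G).sub (integrable_const _)) fun m => ?_
    · filter_upwards [h0] with x hx
      exact sub_eq_zero.1 hx
    have hb : ∀ f : Circ → ℂ, Integrable f haarAddCircle →
        Integrable (fun x => fourier m x * f x) haarAddCircle := fun f hf =>
      hf.bdd_mul (c := 1) (fourier m).continuous.aestronglyMeasurable
        (Filter.Eventually.of_forall fun x => by rw [fourier_apply, Circle.norm_coe])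
    simp only [mul_sub]
    rw [integral_sub (hb _ (integrable_correlation F G)) (hb _ (integrable_const _)),
      integral_fourier_mul_correlation, integral_fourier_const]
    rcases Int.even_or_odd' m with ⟨r, rfl | rfl⟩
    · have h1 := hasSum_integral_fourier hF hG (2 * (-r))
      rw [show -(2 * -r) = 2 * r by ring] at h1
      rw [h1.unique (h (-r)), zpow_mul]
      simp only [neg_eq_zero, mul_eq_zero, OfNat.ofNat_ne_zero, false_or]
      split_ifs <;> norm_num
    · rw [Odd.neg_one_zpow ⟨r, rfl⟩, if_neg (by omega)]
      ring

theorem measurable_correlation (F G : L2C) : Measurable (correlation F G) := by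
  have hF := (Lp.stronglyMeasurable F).measurable
  have hG := (Lp.stronglyMeasurable G).measurable
  have hs : Measurable fun x : Circ => x + halfTurn := measurable_add_const _
  exact ((continuous_conj.measurable.comp hF).mul hG).add
    ((continuous_conj.measurable.comp (hF.comp hs)).mul (hG.comp hs))

end Correlation

/-- Dilation by `b` preserves null sets, and the line is a countable union of periods, each
projecting to the circle in a measure-preserving way. -/
theorem ae_real_iff_ae_circle {P : Circ → Prop} (hP : MeasurableSet {x | P x}) {b : ℝ}
    (hb : b ≠ 0) : (∀ᵐ u : ℝ, P ((u / b : ℝ) : Circ)) ↔ ∀ᵐ x ∂haarAddCircle, P x := by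
  have hq : ∀ a : ℝ, a ≠ 0 →
      Measure.QuasiMeasurePreserving (fun t : ℝ => a * t) volume volume := fun a ha =>
    ⟨measurable_const_mul a, by
      rw [Real.map_volume_mul_left ha]; exact Measure.smul_absolutelyContinuous⟩
  have h1 : (∀ᵐ u : ℝ, P ((u / b : ℝ) : Circ)) ↔ ∀ᵐ u : ℝ, P (u : Circ) := by
    constructor
    · intro h
      filter_upwards [(hq b hb).ae h] with u hu
      rwa [mul_div_cancel_left₀ _ hb] at hu
    · intro h
      filter_upwards [(hq b⁻¹ (inv_ne_zero hb)).ae h] with u hu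
      rwa [inv_mul_eq_div] at hu
  have h2 : (∀ᵐ x ∂haarAddCircle, P x) ↔ ∀ᵐ x : Circ, P x := by
    rw [volume_eq_smul_haarAddCircle]
    exact (Measure.ae_ennreal_smul_measure_iff
      (by simp [Real.pi_pos])).symm
  have h3 : ∀ t : ℝ, (∀ᵐ x : Circ, P x) ↔
      ∀ᵐ u : ℝ ∂(volume.restrict (Set.Ioc t (t + 2 * Real.pi))), P (u : Circ) := by
    intro t
    rw [← (AddCircle.measurePreserving_mk (2 * Real.pi) t).map_eq]
    exact ae_map_iff (AddCircle.measurePreserving_mk (2 * Real.pi) t).aemeasurable hP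
  rw [h1, h2]
  constructor
  · intro h
    exact (h3 0).2 (ae_restrict_of_ae h)
  · intro h
    have h4 := iUnion_Ioc_add_zsmul Real.two_pi_pos 0
    have h5 : ∀ᵐ u : ℝ ∂(volume.restrict (⋃ n : ℤ, Set.Ioc (0 + n • (2 * Real.pi))
        (0 + (n + 1) • (2 * Real.pi)))), P (u : Circ) := by
      rw [ae_restrict_iUnion_iff]
      intro n
      have := (h3 (0 + n • (2 * Real.pi))).1 h
      rwa [add_assoc, ← add_one_zsmul] at this
    rwa [h4, Measure.restrict_univ] at h5

/-! ### Calculus of the affine chirp isometries of `L²(ℝ)`. -/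

section Operators

theorem modulated_coeFn (f : L2R) (r : ℂ) {a : ℝ} (ha : a ≠ 0) (b : ℝ) {θ : ℝ → ℝ}
    (hθ : Continuous θ) : ⇑(memLp_modulated f r ha b hθ).toLp =ᵐ[volume]
      fun t : ℝ => r * f (a * t - b) * cexp (I / 2 * (θ t : ℂ)) :=
  (memLp_modulated f r ha b hθ).coeFn_toLp

theorem quasiMeasurePreserving_affine {a : ℝ} (ha : a ≠ 0) (b : ℝ) :
    Measure.QuasiMeasurePreserving (fun t : ℝ => a * t - b) volume volume := by
  refine (measurePreserving_sub_right volume b).quasiMeasurePreserving.comp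
    ⟨measurable_const_mul a, ?_⟩
  rw [Real.map_volume_mul_left ha]
  exact Measure.smul_absolutelyContinuous

theorem norm_cexp_half (x : ℝ) : ‖cexp (I / 2 * (x : ℂ))‖ = 1 := by
  rw [show I / 2 * (x : ℂ) = ((x / 2 : ℝ) : ℂ) * I by push_cast; ring]
  exact norm_exp_ofReal_mul_I _

theorem norm_modulated (f : L2R) (r : ℂ) {a : ℝ} (ha : a ≠ 0) (b : ℝ) {θ : ℝ → ℝ}
    (hθ : Continuous θ) (hr : ‖r‖ ^ 2 = |a|) : ‖(memLp_modulated f r ha b hθ).toLp‖ = ‖f‖ := by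
  have key : ∀ g : L2R, ‖g‖ ^ 2 = ∫ t, ‖g t‖ ^ 2 := fun g => by
    have h : inner ℂ g g = ((∫ t, ‖g t‖ ^ 2 : ℝ) : ℂ) := by
      rw [L2.inner_def, show ((∫ t, ‖g t‖ ^ 2 : ℝ) : ℂ) = ∫ t, ((‖g t‖ ^ 2 : ℝ) : ℂ) from
        integral_ofReal.symm]
      simp only [inner_self_eq_norm_sq_to_K]
      simp
    rw [inner_self_eq_norm_sq_to_K] at h
    exact Complex.ofReal_injective (by simpa using h)
  have hsq : ‖(memLp_modulated f r ha b hθ).toLp‖ ^ 2 = ‖f‖ ^ 2 := by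
    rw [key, key]
    have h1 : ∫ t, ‖((memLp_modulated f r ha b hθ).toLp : L2R) t‖ ^ 2
        = ∫ t, |a| * ‖f (a * t - b)‖ ^ 2 := by
      refine integral_congr_ae ?_
      filter_upwards [modulated_coeFn f r ha b hθ] with t ht
      rw [ht, norm_mul, norm_mul, norm_cexp_half, mul_one, mul_pow, hr]
    rw [h1, integral_const_mul, Measure.integral_comp_mul_left (fun t => ‖f (t - b)‖ ^ 2),
      integral_sub_right_eq_self (fun t => ‖f t‖ ^ 2), smul_eq_mul, ← mul_assoc, abs_inv,
      mul_inv_cancel₀ (abs_ne_zero.2 ha), one_mul]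
  exact (pow_left_inj₀ (norm_nonneg _) (norm_nonneg _) two_ne_zero).1 hsq

theorem norm_ofReal_sqrt_abs_sq (a : ℝ) : ‖((√|a| : ℝ) : ℂ)‖ ^ 2 = |a| := by
  rw [Complex.norm_real, Real.norm_of_nonneg (Real.sqrt_nonneg _), Real.sq_sqrt (abs_nonneg _)]

/-- The isometry `f ↦ (t ↦ |a|^{1/2} f(at - b) e^{iθ(t)/2})` of `L²(ℝ)`. -/
def chirpIsometry {a : ℝ} (ha : a ≠ 0) (b : ℝ) {θ : ℝ → ℝ} (hθ : Continuous θ) :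
    L2R →ₗᵢ[ℂ] L2R where
  toFun f := (memLp_modulated f ((√|a| : ℝ) : ℂ) ha b hθ).toLp
  map_add' f g := by
    refine Lp.ext ?_
    filter_upwards [modulated_coeFn (f + g) ((√|a| : ℝ) : ℂ) ha b hθ,
      modulated_coeFn f ((√|a| : ℝ) : ℂ) ha b hθ, modulated_coeFn g ((√|a| : ℝ) : ℂ) ha b hθ,
      Lp.coeFn_add (memLp_modulated f ((√|a| : ℝ) : ℂ) ha b hθ).toLp
        (memLp_modulated g ((√|a| : ℝ) : ℂ) ha b hθ).toLp,
      (quasiMeasurePreserving_affine ha b).ae (Lp.coeFn_add f g)] with t h1 h2 h3 h4 h5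
    rw [h4, h1, Pi.add_apply, h2, h3, h5, Pi.add_apply]
    ring
  map_smul' c f := by
    refine Lp.ext ?_
    filter_upwards [modulated_coeFn (c • f) ((√|a| : ℝ) : ℂ) ha b hθ,
      modulated_coeFn f ((√|a| : ℝ) : ℂ) ha b hθ,
      Lp.coeFn_smul c (memLp_modulated f ((√|a| : ℝ) : ℂ) ha b hθ).toLp,
      (quasiMeasurePreserving_affine ha b).ae (Lp.coeFn_smul c f)] with t h1 h2 h4 h5
    rw [RingHom.id_apply, h4, h1, Pi.smul_apply, h2, h5, Pi.smul_apply]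
    simp only [smul_eq_mul]
    ring
  norm_map' f := norm_modulated f _ ha b hθ (norm_ofReal_sqrt_abs_sq a)

theorem chirpIsometry_coeFn {a : ℝ} (ha : a ≠ 0) (b : ℝ) {θ : ℝ → ℝ} (hθ : Continuous θ)
    (f : L2R) : ⇑(chirpIsometry ha b hθ f) =ᵐ[volume]
      fun t : ℝ => ((√|a| : ℝ) : ℂ) * f (a * t - b) * cexp (I / 2 * (θ t : ℂ)) :=
  modulated_coeFn f _ ha b hθ

/-- Scale and shift are matched through equations, because parameters such as `2 * 2 ^ 0` and `2 ^
1` agree only after computation. -/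
theorem modulated_eq_smul (f : L2R) (r c : ℂ) {a a' b b' : ℝ} (ha : a ≠ 0) (ha' : a' ≠ 0)
    {θ θ' : ℝ → ℝ} (hθ : Continuous θ) (hθ' : Continuous θ') (haa : a = a') (hbb : b = b')
    (h : ∀ t, r * cexp (I / 2 * (θ t : ℂ))
      = c * (((√|a| : ℝ) : ℂ) * cexp (I / 2 * (θ' t : ℂ)))) :
    (memLp_modulated f r ha b hθ).toLp = c • chirpIsometry ha' b' hθ' f := by
  subst haa hbb
  refine Lp.ext ?_
  filter_upwards [modulated_coeFn f r ha b hθ, chirpIsometry_coeFn ha b hθ' f,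
    Lp.coeFn_smul c (chirpIsometry ha b hθ' f)] with t h1 h2 h3
  rw [h1, h3, Pi.smul_apply, h2, smul_eq_mul]
  linear_combination f (a * t - b) * h t

theorem chirpIsometry_eq_smul (f : L2R) (γ : ℝ) {a a' b b' : ℝ} (ha : a ≠ 0) (ha' : a' ≠ 0)
    {θ θ' : ℝ → ℝ} (hθ : Continuous θ) (hθ' : Continuous θ') (haa : a = a') (hbb : b = b')
    (h : ∀ t, θ t = γ + θ' t) :
    chirpIsometry ha b hθ f = cexp (I / 2 * (γ : ℂ)) • chirpIsometry ha' b' hθ' f := by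
  refine modulated_eq_smul f _ _ ha ha' hθ hθ' haa hbb fun t => ?_
  rw [h, ofReal_add, mul_add, Complex.exp_add]
  ring

theorem chirpIsometry_congr (f : L2R) {a a' b b' : ℝ} (ha : a ≠ 0) (ha' : a' ≠ 0)
    {θ θ' : ℝ → ℝ} (hθ : Continuous θ) (hθ' : Continuous θ') (haa : a = a') (hbb : b = b')
    (h : ∀ t, θ t = θ' t) :
    chirpIsometry ha b hθ f = chirpIsometry ha' b' hθ' f := by
  have := chirpIsometry_eq_smul f 0 ha ha' hθ hθ' haa hbb (by simpa using h)
  simpa using this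

theorem chirpIsometry_chirpIsometry (f : L2R) {a a' b b' : ℝ} (ha : a ≠ 0) (ha' : a' ≠ 0)
    {θ θ' : ℝ → ℝ} (hθ : Continuous θ) (hθ' : Continuous θ') :
    chirpIsometry ha b hθ (chirpIsometry ha' b' hθ' f)
      = chirpIsometry (mul_ne_zero ha' ha) (a' * b + b')
        (θ := fun t => θ t + θ' (a * t - b)) (by fun_prop) f := by
  refine Lp.ext ?_
  filter_upwards [chirpIsometry_coeFn ha b hθ (chirpIsometry ha' b' hθ' f),
    (quasiMeasurePreserving_affine ha b).ae (chirpIsometry_coeFn ha' b' hθ' f),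
    chirpIsometry_coeFn (mul_ne_zero ha' ha) (a' * b + b')
      (θ := fun t => θ t + θ' (a * t - b)) (by fun_prop) f] with t h1 h2 h3
  rw [h1, h2, h3, abs_mul, Real.sqrt_mul (abs_nonneg _), ofReal_add, mul_add, Complex.exp_add,
    show a' * (a * t - b) - b' = a' * a * t - (a' * b + b') by ring]
  push_cast
  ring

theorem chirpIsometry_one (f : L2R) {a b : ℝ} (ha : a ≠ 0) {θ : ℝ → ℝ} (hθ : Continuous θ)
    (ha1 : a = 1) (hb : b = 0) (h : ∀ t, θ t = 0) : chirpIsometry ha b hθ f = f := by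
  subst ha1 hb
  refine Lp.ext ?_
  filter_upwards [chirpIsometry_coeFn ha 0 hθ f] with t h1
  rw [h1]
  simp [h]

end Operators

/-! ### Wavelet families under dilation and translation. -/

section Families

variable (M₁ M₂ : SL(2, ℝ))

/-- The member of index `(m, n)` of the wavelet family generated by `f`, without the constant
phase. -/
def dilate (m n : ℤ) : L2R →ₗᵢ[ℂ] L2R :=
  chirpIsometry (zpow_ne_zero m (two_ne_zero' ℝ)) (n : ℝ)
    (θ := fun t => -(t ^ 2 * (M₁ 0 0 / M₁ 0 1)) + (2 ^ m * t - n) ^ 2 * (M₂ 0 0 / M₂ 0 1)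
      + 2 * (2 ^ m * t - n) / M₁ 0 1) (by fun_prop)

/-- The constant phase of the member of index `(m, n)` of a wavelet family. -/
def phase (m n : ℤ) : ℂ :=
  cexp (I / 2 * ((((n : ℝ) / 2 ^ m) ^ 2 * (M₁ 0 0 / M₁ 0 1) + 4 * n / M₁ 0 1 : ℝ) : ℂ))

/-- The unitary dilation by `2` that intertwines the levels of a multiresolution analysis. -/
def levelUp : L2R →ₗᵢ[ℂ] L2R :=
  chirpIsometry (two_ne_zero' ℝ) 0
    (θ := fun t => M₁ 0 0 / M₁ 0 1 * ((2 * t) ^ 2 - t ^ 2)) (by fun_prop)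

/-- Translation by `k`, conjugated with a chirp. -/
def chirpTranslate (k : ℤ) : L2R →ₗᵢ[ℂ] L2R :=
  chirpIsometry (one_ne_zero (α := ℝ)) (k : ℝ)
    (θ := fun t => M₁ 0 0 / M₁ 0 1 * ((t - k) ^ 2 - t ^ 2)) (by fun_prop)

theorem norm_phase (m n : ℤ) : ‖phase M₁ m n‖ = 1 := norm_cexp_half _

theorem phase_zero_zero : phase M₁ 0 0 = 1 := by simp [phase]

theorem phase_one (n : ℤ) : phase M₁ 1 n = cexp (I / 2 *
    (((n : ℝ) ^ 2 * M₁ 0 0 / (4 * M₁ 0 1) + 4 * (n : ℝ) / M₁ 0 1 : ℝ) : ℂ)) := by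
  rw [phase]
  congr 3
  rw [zpow_one, div_pow, div_mul_div_comm]
  norm_num

theorem two_rpow_half (m : ℤ) : (2 : ℝ) ^ ((m : ℝ) / 2) = √|(2 : ℝ) ^ m| := by
  rw [abs_of_pos (by positivity), Real.sqrt_eq_rpow, ← Real.rpow_intCast, ← Real.rpow_mul (by simp)]
  congr 1
  ring

theorem family_eq (f : L2R) (m n : ℤ) :
    family M₁ M₂ f m n = phase M₁ m n • dilate M₁ M₂ m n f := by
  refine modulated_eq_smul f _ _ (zpow_ne_zero m (two_ne_zero' ℝ)) _ (by fun_prop) _ rfl rfl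
    fun t => ?_
  rw [two_rpow_half, phase, mul_left_comm, ← Complex.exp_add, ← mul_add, ← ofReal_add]
  congr 4
  ring

/-- The phases of `atom` are built for this: `t² + (3t² - 4tn + n²) = (2t - n)²` for the `M₂` chirp,
and `2t + 2(t + n) = 2(2t - n) + 4n` for the linear term, where `4n` goes into `phase`. -/
theorem dilate_atom (f : L2R) (n : ℤ) :
    dilate M₁ M₂ 0 0 (atom M₁ M₂ f n) = phase M₁ 1 n • dilate M₁ M₂ 1 n f := by
  have h : atom M₁ M₂ f n = chirpIsometry (two_ne_zero' ℝ) (n : ℝ)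
      (θ := fun t => (n : ℝ) ^ 2 * M₁ 0 0 / (4 * M₁ 0 1)
      + (3 * t ^ 2 - 4 * t * n + (n : ℝ) ^ 2) * (M₂ 0 0 / M₂ 0 1)
      + 2 * (t + n) / M₁ 0 1) (by fun_prop) f := by
    rw [← one_smul ℂ (chirpIsometry _ _ _ f)]
    refine modulated_eq_smul f _ _ (two_ne_zero' ℝ) _ (by fun_prop) _ rfl rfl fun t => ?_
    rw [one_mul, abs_of_pos (two_pos (α := ℝ))]
  rw [h, dilate, chirpIsometry_chirpIsometry]
  refine chirpIsometry_eq_smul f _ _ _ _ _ (by simp) (by simp) fun t => ?_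
  simp only [zpow_zero, zpow_one, Int.cast_zero, one_mul, sub_zero]
  rw [div_pow, div_mul_div_comm]
  ring

theorem levelUp_eq (f : L2R) : levelUp M₁ f = ((√2 : ℝ) : ℂ) • chirpDilation M₁ f := by
  have h : chirpDilation M₁ f = ((√2 : ℝ) : ℂ)⁻¹ • levelUp M₁ f := by
    refine modulated_eq_smul f _ _ (two_ne_zero' ℝ) _ (by fun_prop) _ rfl rfl fun t => ?_
    rw [abs_of_pos (two_pos (α := ℝ)), ← mul_assoc, inv_mul_cancel₀ (by simp)]
  rw [h, smul_smul, mul_inv_cancel₀ (by simp), one_smul]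

theorem levelUp_surjective : Function.Surjective (levelUp M₁) := by
  intro f
  refine ⟨chirpIsometry (inv_ne_zero (two_ne_zero' ℝ)) 0
    (θ := fun t => -(M₁ 0 0 / M₁ 0 1 * (t ^ 2 - (t / 2) ^ 2))) (by fun_prop) f, ?_⟩
  rw [levelUp, chirpIsometry_chirpIsometry]
  refine chirpIsometry_one f _ _ (by norm_num) (by simp) fun t => ?_
  ring

theorem levelUp_dilate (f : L2R) (m n : ℤ) :
    levelUp M₁ (dilate M₁ M₂ m n f) = dilate M₁ M₂ (m + 1) n f := by
  have h2 : (2 : ℝ) ^ (m + 1) = 2 ^ m * 2 := zpow_add_one₀ two_ne_zero m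
  rw [levelUp, dilate, chirpIsometry_chirpIsometry]
  refine chirpIsometry_congr f _ _ _ _ h2.symm (by simp) fun t => ?_
  rw [h2]
  ring

theorem chirpTranslate_dilate_zero (f : L2R) (k n : ℤ) :
    chirpTranslate M₁ k (dilate M₁ M₂ 0 n f) = dilate M₁ M₂ 0 (n + k) f := by
  rw [chirpTranslate, dilate, chirpIsometry_chirpIsometry]
  refine chirpIsometry_congr f _ _ _ _ (by simp) (by simp [add_comm]) fun t => ?_
  push_cast
  simp only [zpow_zero]
  ring

/-- A unit translation is two steps at scale 1, as `2(t - k) - n = 2t - (n + 2k)`. The chirp of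
`chirpTranslate` restores the factor in `t²` that translation would spoil. -/
theorem chirpTranslate_dilate_one (f : L2R) (k n : ℤ) :
    chirpTranslate M₁ k (dilate M₁ M₂ 1 n f) = dilate M₁ M₂ 1 (n + 2 * k) f := by
  rw [chirpTranslate, dilate, chirpIsometry_chirpIsometry]
  refine chirpIsometry_congr f _ _ _ _ (by simp) (by push_cast; simp [add_comm]) fun t => ?_
  push_cast
  simp only [zpow_one]
  ring

/-- Two-scale expansions are preserved by integer translations. -/
theorem hasSum_dilate_translate {f g : L2R} {a : ℤ → ℂ}
    (h : HasSum (fun n => a n • dilate M₁ M₂ 1 n f) (dilate M₁ M₂ 0 0 g)) (k : ℤ) :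
    HasSum (fun n => a n • dilate M₁ M₂ 1 (n + 2 * k) f) (dilate M₁ M₂ 0 k g) := by
  have := h.mapL (chirpTranslate M₁ k).toContinuousLinearMap
  simpa [chirpTranslate_dilate_zero, chirpTranslate_dilate_one] using this

theorem hasSum_dilate_of_hasSum_atom {f g : L2R} {d : ℤ → ℂ}
    (h : HasSum (fun n => d n • atom M₁ M₂ f n) g) :
    HasSum (fun n => (d n * phase M₁ 1 n) • dilate M₁ M₂ 1 n f) (dilate M₁ M₂ 0 0 g) := by
  have := h.mapL (dilate M₁ M₂ 0 0).toContinuousLinearMap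
  simpa [dilate_atom, smul_smul] using this

end Families

/-! ### Invariance of orthonormal bases under phases and unitaries. -/

section Bases

theorem IsONBOf.unimodular_smul {ι : Type*} {v : ι → L2R} {K : Submodule ℂ L2R} {c : ι → ℂ}
    (hc : ∀ i, ‖c i‖ = 1) (h : IsONBOf v K) : IsONBOf (fun i => c i • v i) K := by
  have hc0 : ∀ i, c i ≠ 0 := fun i h0 => by simpa [h0] using hc i
  refine ⟨⟨fun i => by rw [norm_smul, hc, h.1.1, one_mul], fun i j hij => ?_⟩, ?_⟩
  · change inner ℂ (c i • v i) (c j • v j) = 0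
    rw [inner_smul_left, inner_smul_right, h.1.2 hij, mul_zero, mul_zero]
  · rw [← h.2]
    congr 1
    refine le_antisymm (Submodule.span_le.2 ?_) (Submodule.span_le.2 ?_)
    · rintro _ ⟨i, rfl⟩
      exact Submodule.smul_mem _ _ (Submodule.subset_span (Set.mem_range_self i))
    · rintro _ ⟨i, rfl⟩
      have := Submodule.smul_mem (Submodule.span ℂ (Set.range fun i => c i • v i)) (c i)⁻¹
        (Submodule.subset_span (Set.mem_range_self i))
      simpa [smul_smul, hc0] using this

theorem isONBOf_unimodular_smul_iff {ι : Type*} {v : ι → L2R} {K : Submodule ℂ L2R} {c : ι → ℂ}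
    (hc : ∀ i, ‖c i‖ = 1) : IsONBOf (fun i => c i • v i) K ↔ IsONBOf v K := by
  refine ⟨fun h => ?_, IsONBOf.unimodular_smul hc⟩
  have hc0 : ∀ i, c i ≠ 0 := fun i h0 => by simpa [h0] using hc i
  have := h.unimodular_smul (c := fun i => (c i)⁻¹) (fun i => by rw [norm_inv, hc, inv_one])
  simpa [smul_smul, hc0] using this

theorem IsONBOf.mem {ι : Type*} {v : ι → L2R} {K : Submodule ℂ L2R} (h : IsONBOf v K) (i : ι) :
    v i ∈ K :=
  h.2 ▸ Submodule.le_topologicalClosure _ (Submodule.subset_span (Set.mem_range_self i))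

theorem IsONBOf.eq_zero {ι : Type*} {v : ι → L2R} {K : Submodule ℂ L2R} (h : IsONBOf v K)
    {w : L2R} (hw : w ∈ K) (hvw : ∀ i, inner ℂ (v i) w = 0) : w = 0 :=
  inner_self_eq_zero.1 (eq_zero_of_inner_closure_span h.2 hvw hw)

theorem isONBOf_iff {ι : Type*} {v : ι → L2R} {K : Submodule ℂ L2R} (hK : IsClosed (K : Set L2R)) :
    IsONBOf v K ↔ Orthonormal ℂ v ∧ (∀ i, v i ∈ K) ∧
      ∀ w ∈ K, (∀ i, inner ℂ (v i) w = 0) → w = 0 :=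
  ⟨fun h => ⟨h.1, h.mem, fun _ hw => h.eq_zero hw⟩,
    fun h => ⟨h.1, closure_span_eq_of_forall hK h.2.1 h.2.2⟩⟩

theorem isONBOf_map_iff {ι : Type*} {v : ι → L2R} {K K' : Submodule ℂ L2R}
    (hK : IsClosed (K : Set L2R)) (hK' : IsClosed (K' : Set L2R)) {U : L2R →ₗᵢ[ℂ] L2R}
    (hU : Function.Surjective U) (hKK' : ∀ x, x ∈ K ↔ U x ∈ K') :
    IsONBOf v K ↔ IsONBOf (fun i => U (v i)) K' := by
  rw [isONBOf_iff hK, isONBOf_iff hK']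
  refine and_congr (U.orthonormal_comp_iff (v := v)).symm
    (and_congr (forall_congr' fun i => hKK' _) ?_)
  constructor
  · intro h w hw hi
    obtain ⟨x, rfl⟩ := hU w
    rw [h x ((hKK' x).2 hw) fun i => by rw [← U.inner_map_map]; exact hi i, map_zero]
  · intro h w hw hi
    have := h (U w) ((hKK' w).1 hw) fun i => by rw [U.inner_map_map]; exact hi i
    exact (map_eq_zero_iff U U.injective).1 this

end Bases

/-! ### The symbol matrix and its unitarity. -/

section SymbolMatrix

theorem unitary_two_by_two_iff (a b c d : ℂ) :
    (((√2 / 2 : ℝ) : ℂ) • !![a, b; c, d]) * (((√2 / 2 : ℝ) : ℂ) • !![a, b; c, d]).conjTranspose = 1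
      ↔ conj a * a + conj b * b = 2 ∧ conj a * c + conj b * d = 0 ∧
        conj c * c + conj d * d = 2 := by
  have hs : ((√2 / 2 : ℝ) : ℂ) * ((√2 / 2 : ℝ) : ℂ) = 1 / 2 := by
    rw [← ofReal_mul, div_mul_div_comm, Real.mul_self_sqrt zero_le_two]
    norm_num
  rw [Matrix.conjTranspose_smul, Matrix.smul_mul, Matrix.mul_smul, smul_smul,
    show star ((√2 / 2 : ℝ) : ℂ) = ((√2 / 2 : ℝ) : ℂ) from conj_ofReal _, hs,
    ← Matrix.ext_iff]
  simp only [Fin.forall_fin_two, Matrix.smul_apply, Matrix.mul_apply, Fin.sum_univ_two,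
    Matrix.conjTranspose_apply, Matrix.of_apply, Matrix.cons_val_zero, Matrix.cons_val_one,
    Matrix.cons_val', Matrix.cons_val_fin_one, smul_eq_mul, Matrix.one_apply_eq,
    Matrix.one_apply_ne (zero_ne_one (α := Fin 2)), Matrix.one_apply_ne (one_ne_zero (α := Fin 2)),
    ← starRingEnd_apply]
  constructor
  · rintro ⟨⟨h1, -⟩, h2, h3⟩
    refine ⟨?_, ?_, ?_⟩
    · linear_combination 2 * h1
    · linear_combination 2 * h2
    · linear_combination 2 * h3
  · rintro ⟨h1, h2, h3⟩
    refine ⟨⟨?_, ?_⟩, ?_, ?_⟩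
    · linear_combination (1 / 2) * h1
    -- The two off-diagonal entries are conjugate to each other, so one equation covers both.
    · have := congrArg conj h2
      simp only [map_add, map_mul, conj_conj, map_zero] at this
      linear_combination (1 / 2) * this
    · linear_combination (1 / 2) * h2
    · linear_combination (1 / 2) * h3

/-- A one-sided inverse of a square matrix is two-sided, so orthonormal rows force orthonormal
columns. -/
theorem columns_orthogonal {a b c d : ℂ} (h1 : conj a * a + conj b * b = 2)
    (h2 : conj a * c + conj b * d = 0) (h3 : conj c * c + conj d * d = 2) :
    conj a * b + conj c * d = 0 := by
  have h := mul_eq_one_comm.1 ((unitary_two_by_two_iff a b c d).2 ⟨h1, h2, h3⟩)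
  have h01 := congrFun (congrFun h 0) 1
  rw [Matrix.conjTranspose_smul, Matrix.smul_mul, Matrix.mul_smul, smul_smul,
    Matrix.one_apply_ne (zero_ne_one (α := Fin 2)), Matrix.smul_apply, smul_eq_mul,
    mul_eq_zero] at h01
  rcases h01 with h01 | h01
  · simp at h01
  · simpa [Matrix.mul_apply, Fin.sum_univ_two] using h01

/-- The quotient is a shift by `π` or `-π` according to the sign of `b`, and these agree modulo
`2π`. -/
theorem coe_half_turn_div {b : ℝ} (hb : b ≠ 0) (u : ℝ) :
    (((u + Real.pi * |b|) / b : ℝ) : Circ) = ((u / b : ℝ) : Circ) + halfTurn := by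
  rw [halfTurn, add_div, AddCircle.coe_add]
  congr 1
  rcases lt_or_gt_of_ne hb with h | h
  · rw [abs_of_neg h, mul_neg, neg_div, mul_div_cancel_right₀ _ hb, ← sub_eq_zero,
      ← AddCircle.coe_sub, AddCircle.coe_eq_zero_iff]
    exact ⟨-1, by rw [neg_one_zsmul]; ring⟩
  · rw [abs_of_pos h, mul_div_cancel_right₀ _ hb]

variable {M₁ M₂ : SL(2, ℝ)} {c d : ℤ → ℂ} {F G : L2C}

theorem symbolMatrix_eq (hB₁ : M₁ 0 1 ≠ 0) (hB₂ : M₂ 0 1 ≠ 0)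
    (hF : HasSum (fun n => (c n * phase M₁ 1 n) • (fourierLp 2 (-n) : L2C)) F)
    (hG : HasSum (fun n => (d n * phase M₁ 1 n) • (fourierLp 2 (-n) : L2C)) G) (u : ℝ) :
    symbolMatrix M₁ M₂ c d u = ((√2 / 2 : ℝ) : ℂ) •
      !![F ((u / M₁ 0 1 : ℝ) : Circ), F (((u / M₁ 0 1 : ℝ) : Circ) + halfTurn);
        G ((u / M₁ 0 1 : ℝ) : Circ), G (((u / M₁ 0 1 : ℝ) : Circ) + halfTurn)] := by
  have hsym : ∀ {a : ℤ → ℂ} {H : L2C},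
      HasSum (fun n => (a n * phase M₁ 1 n) • (fourierLp 2 (-n) : L2C)) H →
      ∀ v : ℝ, symbol M₁ M₂ a v = ((√2 / 2 : ℝ) : ℂ) * H ((v / M₂ 0 1 : ℝ) : Circ) := by
    intro a H h v
    simp only [phase_one] at h
    rw [symbol, h.tsum_eq]
  have e1 : M₂ 0 1 * u / M₁ 0 1 / M₂ 0 1 = u / M₁ 0 1 := by field_simp
  have e2 : M₂ 0 1 / M₁ 0 1 * (u + Real.pi * |M₁ 0 1|) / M₂ 0 1
      = (u + Real.pi * |M₁ 0 1|) / M₁ 0 1 := by field_simp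
  rw [symbolMatrix, hsym hF, hsym hF, hsym hG, hsym hG, e1, e2, coe_half_turn_div hB₁]
  simp [Matrix.smul_of]

theorem symbolMatrix_unitary_iff (hB₁ : M₁ 0 1 ≠ 0) (hB₂ : M₂ 0 1 ≠ 0)
    (hF : HasSum (fun n => (c n * phase M₁ 1 n) • (fourierLp 2 (-n) : L2C)) F)
    (hG : HasSum (fun n => (d n * phase M₁ 1 n) • (fourierLp 2 (-n) : L2C)) G) :
    (∀ᵐ u : ℝ, symbolMatrix M₁ M₂ c d u * (symbolMatrix M₁ M₂ c d u).conjTranspose = 1) ↔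
      ∀ᵐ x ∂haarAddCircle, correlation F F x = 2 ∧ correlation F G x = 0 ∧
        correlation G G x = 2 := by
  rw [← ae_real_iff_ae_circle _ hB₁]
  · refine Filter.eventually_congr (Filter.Eventually.of_forall fun u => ?_)
    rw [symbolMatrix_eq hB₁ hB₂ hF hG, unitary_two_by_two_iff]
    rfl
  · exact (measurableSet_eq_fun (measurable_correlation F F) measurable_const).inter
      ((measurableSet_eq_fun (measurable_correlation F G) measurable_const).inter
        (measurableSet_eq_fun (measurable_correlation G G) measurable_const))

/-- Column orthogonality reads `conj F(x) F(x + π) + conj G(x) G(x + π) = 0` almost everywhere. Its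
integral is the alternating sum, by `hasSum_integral_add_pi`. -/
theorem hasSum_alternating_of_unitary {p q : ℤ → ℂ}
    (hF : HasSum (fun n => p n • (fourierLp 2 (-n) : L2C)) F)
    (hG : HasSum (fun n => q n • (fourierLp 2 (-n) : L2C)) G)
    (h : ∀ᵐ x ∂haarAddCircle, correlation F F x = 2 ∧ correlation F G x = 0 ∧
        correlation G G x = 2) :
    HasSum (fun n : ℤ => (-1 : ℝ) ^ n * (‖p n‖ ^ 2 + ‖q n‖ ^ 2)) 0 := by
  have hint : ∀ H : L2C, Integrable (fun x => conj (H x) * H (x + halfTurn)) haarAddCircle := by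
    intro H
    refine (integrable_conj_mul H (memLp_add_pi H).toLp).congr ?_
    filter_upwards [(memLp_add_pi H).coeFn_toLp] with x hx
    rw [hx]
  have h0 : (∫ x, conj (F x) * F (x + halfTurn) ∂haarAddCircle)
      + ∫ x, conj (G x) * G (x + halfTurn) ∂haarAddCircle = 0 := by
    rw [← integral_add (hint F) (hint G)]
    refine integral_eq_zero_of_ae ?_
    filter_upwards [h] with x hx
    exact columns_orthogonal hx.1 hx.2.1 hx.2.2
  have hs := (hasSum_integral_add_pi hF).add (hasSum_integral_add_pi hG)
  rw [h0] at hs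
  rw [← Complex.hasSum_ofReal]
  convert! hs using 2 with n
  push_cast
  ring

end SymbolMatrix

/-! ### Correlation sums and inner products of translates. -/

section Correlations

variable {E : Type*} [NormedAddCommGroup E] [InnerProductSpace ℂ E]
variable {e : ℤ → E} {p q : ℤ → ℂ} {f g : ℤ → E}

theorem hasSum_correlation_iff (he : Orthonormal ℂ e)
    (hf : ∀ k, HasSum (fun n => p n • e (n + 2 * k)) (f k))
    (hg : ∀ k, HasSum (fun n => q n • e (n + 2 * k)) (g k)) (c : ℂ) :
    (∀ k : ℤ, HasSum (fun n => conj (p n) * q (n - 2 * k)) (if k = 0 then c else 0)) ↔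
      ∀ j k, inner ℂ (f j) (g k) = if j = k then c else 0 := by
  constructor
  · intro h j k
    rw [(hasSum_correlation he hf hg j k).unique (h (k - j))]
    simp only [sub_eq_zero, eq_comm]
  · intro h k
    have := hasSum_correlation he hf hg 0 k
    rw [h, sub_zero] at this
    simpa only [eq_comm] using this

end Correlations

/-! ### Wavelets of the multiresolution analysis. -/

section MRA

variable {M₁ M₂ : SL(2, ℝ)} {V : ℤ → Submodule ℂ L2R} {φ ψ : L2R}

theorem isClosed_waveletSpace (hV : ∀ m, IsClosed (V m : Set L2R)) (m : ℤ) :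
    IsClosed (waveletSpace V m : Set L2R) :=
  (Submodule.isClosed_orthogonal _).inter (hV (m + 1))

theorem isONBOf_family_iff {K : Submodule ℂ L2R} (m : ℤ) (f : L2R) :
    IsONBOf (fun n : ℤ => family M₁ M₂ f m n) K ↔
      IsONBOf (fun n : ℤ => dilate M₁ M₂ m n f) K := by
  simp only [family_eq]
  exact isONBOf_unimodular_smul_iff fun n => norm_phase M₁ m n

namespace IsOrthogonalMRA

variable (hV : IsOrthogonalMRA M₁ M₂ V φ)
include hV

theorem mem_iff_levelUp_mem (m : ℤ) (f : L2R) : f ∈ V m ↔ levelUp M₁ f ∈ V (m + 1) := by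
  rw [hV.mem_iff_chirpDilation_mem, levelUp_eq]
  exact (Submodule.smul_mem_iff _ (by simp)).symm

theorem mem_orthogonal_iff_levelUp_mem (m : ℤ) (f : L2R) :
    f ∈ (V m)ᗮ ↔ levelUp M₁ f ∈ (V (m + 1))ᗮ := by
  rw [Submodule.mem_orthogonal, Submodule.mem_orthogonal]
  constructor
  · intro h u hu
    obtain ⟨x, rfl⟩ := levelUp_surjective M₁ u
    rw [(levelUp M₁).inner_map_map]
    exact h x ((hV.mem_iff_levelUp_mem m x).2 hu)
  · intro h u hu
    rw [← (levelUp M₁).inner_map_map]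
    exact h _ ((hV.mem_iff_levelUp_mem m u).1 hu)

theorem mem_waveletSpace_iff_levelUp_mem (m : ℤ) (f : L2R) :
    f ∈ waveletSpace V m ↔ levelUp M₁ f ∈ waveletSpace V (m + 1) :=
  and_congr (hV.mem_orthogonal_iff_levelUp_mem m f) (hV.mem_iff_levelUp_mem (m + 1) f)

theorem isONBOf_dilate_zero : IsONBOf (fun n : ℤ => dilate M₁ M₂ 0 n φ) (V 0) :=
  (isONBOf_family_iff 0 φ).1 hV.scaling

theorem isONBOf_dilate_one : IsONBOf (fun n : ℤ => dilate M₁ M₂ 1 n φ) (V 1) := by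
  have := (isONBOf_map_iff (hV.isClosed 0) (hV.isClosed (0 + 1)) (levelUp_surjective M₁)
    (hV.mem_iff_levelUp_mem 0)).1 hV.isONBOf_dilate_zero
  simpa only [levelUp_dilate, zero_add] using this

theorem hasSum_scaling : HasSum (fun n => (scalingCoeff M₁ M₂ φ n * phase M₁ 1 n) •
    dilate M₁ M₂ 1 n φ) (dilate M₁ M₂ 0 0 φ) := by
  have h := hasSum_of_mem_closure_span hV.isONBOf_dilate_one.1 (x := dilate M₁ M₂ 0 0 φ)
    (by rw [hV.isONBOf_dilate_one.2]; exact hV.le_succ 0 (hV.isONBOf_dilate_zero.mem 0))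
  convert! h using 3 with n
  rw [scalingCoeff, family_eq, family_eq, phase_zero_zero, one_smul, inner_smul_left,
    mul_right_comm, conj_mul', norm_phase]
  simp

/-- Common end of both parts of the theorem. The two-scale expansion puts the translates of `ψ` in
`V 1`, and `hφψ` puts them in `(V 0)ᗮ`. A vector of `W₀` orthogonal to them is orthogonal to the
translates of `φ` too, so `hpar` makes it orthogonal to the basis of `V 1`. -/
theorem isONBOf_waveletSpace_of_alternating {q : ℤ → ℂ}
    (hψ : HasSum (fun n => q n • dilate M₁ M₂ 1 n φ) (dilate M₁ M₂ 0 0 ψ))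
    (ho : Orthonormal ℂ fun k : ℤ => dilate M₁ M₂ 0 k ψ)
    (hφψ : ∀ j k : ℤ, inner ℂ (dilate M₁ M₂ 0 j φ) (dilate M₁ M₂ 0 k ψ) = 0)
    (hpar : HasSum (fun n : ℤ => (-1 : ℝ) ^ n *
      (‖scalingCoeff M₁ M₂ φ n * phase M₁ 1 n‖ ^ 2 + ‖q n‖ ^ 2)) 0) :
    IsONBOf (fun n : ℤ => family M₁ M₂ ψ 0 n) (waveletSpace V 0) := by
  rw [isONBOf_family_iff, isONBOf_iff (isClosed_waveletSpace hV.isClosed 0)]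
  have hsum := hasSum_dilate_translate M₁ M₂ hψ
  have hort : ∀ k : ℤ, dilate M₁ M₂ 0 k ψ ∈ (V 0)ᗮ := by
    intro k
    rw [Submodule.mem_orthogonal]
    intro u hu
    have hk : ∀ j : ℤ, inner ℂ (dilate M₁ M₂ 0 j φ) (dilate M₁ M₂ 0 k ψ) = 0 := fun j => hφψ j k
    exact eq_zero_of_inner_closure_span hV.isONBOf_dilate_zero.2 hk hu
  have hmem : ∀ k : ℤ, dilate M₁ M₂ 0 k ψ ∈ V (0 + 1) := by
    intro k
    rw [zero_add, ← hV.isONBOf_dilate_one.2]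
    exact mem_closure_span_of_hasSum
      (hasSum_reindex (e := fun n : ℤ => dilate M₁ M₂ 1 n φ) hsum k)
  refine ⟨ho, fun k => ⟨hort k, hmem k⟩, fun w hw hψw => ?_⟩
  · obtain ⟨hw0, hw1⟩ := hw
    have hφw : ∀ k : ℤ, inner ℂ (dilate M₁ M₂ 0 k φ) w = 0 := fun k =>
      Submodule.inner_right_of_mem_orthogonal (hV.isONBOf_dilate_zero.mem k) hw0
    exact hV.isONBOf_dilate_one.eq_zero hw1 fun n =>
      inner_eq_zero_of_orthonormal_pair (e := fun n : ℤ => dilate M₁ M₂ 1 n φ)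
        (f := fun k : ℤ => dilate M₁ M₂ 0 k φ) (g := fun k : ℤ => dilate M₁ M₂ 0 k ψ)
        hV.isONBOf_dilate_one.1 (hasSum_dilate_translate M₁ M₂ hV.hasSum_scaling) hsum
        hV.isONBOf_dilate_zero.1 ho hφψ hpar hφw hψw n

theorem isONBOf_waveletSpace_iff (hB₁ : M₁ 0 1 ≠ 0) (hB₂ : M₂ 0 1 ≠ 0) {d : ℤ → ℂ}
    (hψ : HasSum (fun n : ℤ => d n • atom M₁ M₂ φ n) ψ) :
    IsONBOf (fun n : ℤ => family M₁ M₂ ψ 0 n) (waveletSpace V 0) ↔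
      ∀ᵐ u : ℝ, symbolMatrix M₁ M₂ (scalingCoeff M₁ M₂ φ) d u *
        (symbolMatrix M₁ M₂ (scalingCoeff M₁ M₂ φ) d u).conjTranspose = 1 := by
  have hψ' := hasSum_dilate_of_hasSum_atom M₁ M₂ hψ
  have he := hV.isONBOf_dilate_one.1
  have hf := hasSum_dilate_translate M₁ M₂ hV.hasSum_scaling
  have hg := hasSum_dilate_translate M₁ M₂ hψ'
  obtain ⟨F, hF⟩ := summable_smul_orthonormal orthonormal_fourierLp_neg
    (hasSum_norm_sq_of_hasSum he hV.hasSum_scaling).summable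
  obtain ⟨G, hG⟩ := summable_smul_orthonormal orthonormal_fourierLp_neg
    (hasSum_norm_sq_of_hasSum he hψ').summable
  -- Each entry of `U U* = I` is translated into an orthogonality relation between translates: `φ`
  -- with `φ`, `φ` with `ψ`, `ψ` with `ψ`. The first always holds, since `φ` is a scaling function.
  have hFF := (correlation_ae_eq_iff hF hF 1).trans (hasSum_correlation_iff he hf hf 1)
  have hFG := (correlation_ae_eq_iff hF hG 0).trans (hasSum_correlation_iff he hf hg 0)
  have hGG := (correlation_ae_eq_iff hG hG 1).trans (hasSum_correlation_iff he hg hg 1)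
  simp only [mul_one, mul_zero, ite_self, ← orthonormal_iff_ite] at hFF hFG hGG
  rw [symbolMatrix_unitary_iff hB₁ hB₂ hF hG]
  constructor
  · intro h
    rw [isONBOf_family_iff] at h
    filter_upwards [hFF.2 hV.isONBOf_dilate_zero.1, hFG.2 fun j k =>
      Submodule.inner_right_of_mem_orthogonal (hV.isONBOf_dilate_zero.mem j) (h.mem k).1,
      hGG.2 h.1] with x h1 h2 h3
    exact ⟨h1, h2, h3⟩
  · intro h
    exact hV.isONBOf_waveletSpace_of_alternating hψ' (hGG.1 (h.mono fun _ hx => hx.2.2))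
      (hFG.1 (h.mono fun _ hx => hx.2.1)) (hasSum_alternating_of_unitary hF hG h)

/-- `levelUp` maps `W_m` onto `W_{m+1}` and the family at scale `m` to that at scale `m + 1`, so the
basis property spreads to all scales, upwards and downwards. Different scales are orthogonal because
`W_m ⊆ V_{m+1} ⊆ V_{m'}` for `m < m'`, while `W_{m'}` is orthogonal to `V_{m'}`. -/
theorem isONBOf_top
    (h : IsONBOf (fun n : ℤ => family M₁ M₂ ψ 0 n) (waveletSpace V 0)) :
    IsONBOf (fun p : ℤ × ℤ => family M₁ M₂ ψ p.1 p.2) ⊤ := by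
  have hstep : ∀ m : ℤ, IsONBOf (fun n : ℤ => dilate M₁ M₂ m n ψ) (waveletSpace V m) ↔
      IsONBOf (fun n : ℤ => dilate M₁ M₂ (m + 1) n ψ) (waveletSpace V (m + 1)) := by
    intro m
    have := isONBOf_map_iff (v := fun n : ℤ => dilate M₁ M₂ m n ψ)
      (isClosed_waveletSpace hV.isClosed m) (isClosed_waveletSpace hV.isClosed (m + 1))
      (levelUp_surjective M₁) (hV.mem_waveletSpace_iff_levelUp_mem m)
    simpa only [levelUp_dilate] using this
  have hall : ∀ m : ℤ, IsONBOf (fun n : ℤ => dilate M₁ M₂ m n ψ) (waveletSpace V m) := by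
    intro m
    induction m using Int.induction_on with
    | zero => exact (isONBOf_family_iff 0 ψ).1 h
    | succ i ih => exact (hstep _).1 ih
    | pred i ih => rw [hstep]; simpa using ih
  have hmono : Monotone V := monotone_int_of_le_succ hV.le_succ
  have hlt : ∀ {m m' : ℤ} (n n' : ℤ), m < m' →
      inner ℂ (dilate M₁ M₂ m n ψ) (dilate M₁ M₂ m' n' ψ) = 0 := fun n n' hmm =>
    Submodule.inner_right_of_mem_orthogonal
      (hmono (Int.add_one_le_iff.2 hmm) ((hall _).mem n).2) ((hall _).mem n').1
  simp only [family_eq]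
  refine IsONBOf.unimodular_smul (c := fun p : ℤ × ℤ => phase M₁ p.1 p.2)
    (v := fun p : ℤ × ℤ => dilate M₁ M₂ p.1 p.2 ψ) (fun p => norm_phase M₁ _ _) ?_
  rw [isONBOf_iff (by exact isClosed_univ)]
  refine ⟨⟨fun p => (hall p.1).1.1 p.2, ?_⟩, fun _ => Submodule.mem_top, fun w _ hw => ?_⟩
  · rintro ⟨m, n⟩ ⟨m', n'⟩ hne
    rcases lt_trichotomy m m' with hm | rfl | hm
    · exact hlt n n' hm
    · exact (hall m).1.2 fun hn => hne (Prod.ext rfl hn)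
    · change inner ℂ (dilate M₁ M₂ m n ψ) (dilate M₁ M₂ m' n' ψ) = 0
      rw [← inner_conj_symm, hlt n' n hm, map_zero]
  · exact eq_zero_of_orthogonal_differences hV.isClosed hV.le_succ hV.iInter_eq hV.dense_iUnion
      fun m x hx => eq_zero_of_inner_closure_span (hall m).2 (fun n => hw (m, n)) hx

end IsOrthogonalMRA

/-- The exponential in `mirrorCoeff` is chosen so that, after multiplication by `phase M₁ 1 k`,
exactly the conjugate of `phase M₁ 1 (1 - k)` remains. In the basis `dilate M₁ M₂ 1` the
coefficients then satisfy the classical mirror relation. -/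
theorem mirrorCoeff_mul_phase (c : ℤ → ℂ) (k : ℤ) :
    mirrorCoeff M₁ c k * phase M₁ 1 k
      = (-1) ^ (1 - k) * conj (c (1 - k) * phase M₁ 1 (1 - k)) := by
  rw [mirrorCoeff, map_mul, mul_assoc, mul_assoc, phase_one, phase_one, ← exp_conj,
    ← Complex.exp_add]
  congr 4
  rw [map_mul, conj_ofReal, map_div₀, conj_I, show conj (2 : ℂ) = 2 from conj_ofNat 2]
  push_cast
  ring

namespace IsOrthogonalMRA

variable (hV : IsOrthogonalMRA M₁ M₂ V φ)
include hV

theorem orthonormal_atom : Orthonormal ℂ (atom M₁ M₂ φ) := by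
  rw [← (dilate M₁ M₂ 0 0).orthonormal_comp_iff]
  have := (hV.isONBOf_dilate_one.unimodular_smul (norm_phase M₁ 1)).1
  simpa only [Function.comp_def, dilate_atom] using this

theorem exists_hasSum_mirror : ∃ ψ : L2R,
    HasSum (fun k : ℤ => mirrorCoeff M₁ (scalingCoeff M₁ M₂ φ) k • atom M₁ M₂ φ k) ψ ∧
    IsONBOf (fun n : ℤ => family M₁ M₂ ψ 0 n) (waveletSpace V 0) := by
  have he := hV.isONBOf_dilate_one.1
  have hf := hasSum_dilate_translate M₁ M₂ hV.hasSum_scaling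
  have hp := (hasSum_norm_sq_of_hasSum he hV.hasSum_scaling).summable
  have hq := mirrorCoeff_mul_phase (M₁ := M₁) (scalingCoeff M₁ M₂ φ)
  have hd : Summable fun k => ‖mirrorCoeff M₁ (scalingCoeff M₁ M₂ φ) k‖ ^ 2 := by
    refine ((Equiv.subLeft (1 : ℤ)).summable_iff.2 hp).congr fun k => ?_
    have := congrArg (‖·‖ ^ 2) (hq k)
    simpa [norm_phase] using this.symm
  obtain ⟨ψ, hψ⟩ := summable_smul_orthonormal hV.orthonormal_atom hd
  have hψ' := hasSum_dilate_of_hasSum_atom M₁ M₂ hψ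
  have hg := hasSum_dilate_translate M₁ M₂ hψ'
  refine ⟨ψ, hψ, hV.isONBOf_waveletSpace_of_alternating hψ' ?_ ?_ ?_⟩
  · rw [orthonormal_iff_ite]
    intro j k
    rw [inner_mirror he hf hg hq, orthonormal_iff_ite.1 hV.isONBOf_dilate_zero.1]
    simp only [neg_inj, eq_comm]
  · exact inner_mirror_eq_zero he hf hg hq
  · exact hasSum_mirror_alternating hp hq

end IsOrthogonalMRA

end MRA

end LCWavelet

end

theorem mainTheorem6 (M₁ M₂ : SL(2, ℝ)) (hB₁ : M₁ 0 1 ≠ 0) (hB₂ : M₂ 0 1 ≠ 0)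
    (V : ℤ → Submodule ℂ LCWavelet.L2R) (φ : LCWavelet.L2R)
    (hV : LCWavelet.IsOrthogonalMRA M₁ M₂ V φ) :
    (∀ (ψ : LCWavelet.L2R) (d : ℤ → ℂ),
      HasSum (fun n : ℤ => d n • LCWavelet.atom M₁ M₂ φ n) ψ →
      (LCWavelet.IsONBOf (fun n : ℤ => LCWavelet.family M₁ M₂ ψ 0 n)
          (LCWavelet.waveletSpace V 0) ↔
        ∀ᵐ u : ℝ,
          LCWavelet.symbolMatrix M₁ M₂ (LCWavelet.scalingCoeff M₁ M₂ φ) d u *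
            (LCWavelet.symbolMatrix M₁ M₂ (LCWavelet.scalingCoeff M₁ M₂ φ) d u).conjTranspose
              = 1)) ∧
    (∃ ψ : LCWavelet.L2R,
      HasSum (fun k : ℤ =>
        LCWavelet.mirrorCoeff M₁ (LCWavelet.scalingCoeff M₁ M₂ φ) k •
          LCWavelet.atom M₁ M₂ φ k) ψ ∧
      LCWavelet.IsONBOf (fun n : ℤ => LCWavelet.family M₁ M₂ ψ 0 n)
        (LCWavelet.waveletSpace V 0) ∧
      LCWavelet.IsONBOf (fun p : ℤ × ℤ => LCWavelet.family M₁ M₂ ψ p.1 p.2) ⊤) := by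
  refine ⟨fun ψ d hψ => hV.isONBOf_waveletSpace_iff hB₁ hB₂ hψ, ?_⟩
  obtain ⟨ψ, hψ, hW⟩ := hV.exists_hasSum_mirror
  exact ⟨ψ, hψ, hW, hV.isONBOf_top hW⟩
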